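/- Let \(G\) be a finite weighted multigraph on \(n\) vertices (parallel edges and loops allowed, all edge weights strictly positive) with \(v\) connected components, and let \(V_i\) be the vertex set of the component containing \(i\). Let \(\varepsilon_{ij}\) be the total weight of the edges joining \(i\) and \(j\), and let \(L\) be the Laplacian matrix, \(\ell_{ij}=-\varepsilon_{ij}\) for \(i\ne j\), \(\ell_{ii}=\sum_{j\ne i}\varepsilon_{ij}\). Let \(\bar J\) be the matrix with \(\bar J_{ij}=1/|V_i|\) if \(j\in V_i\) and \(\bar J_{ij}=0\) otherwise. A spanning rooted forest is a spanning acyclic subgraph with one marked vertex (root) in each of its components; its weight is the product of its edge weights (\(1\) if there are no edges). Let \(\varepsilon(\mathcal F_k)\) be the total weight of the spanning rooted forests with exactly \(k\) edges (\(0\) if there are none), and let \(Q_k\) be the matrix whose \((i,j)\) entry is the total weight of those of them in which \(j\) belongs to the tree rooted at \(i\). Call \(\alpha\) admissible for \(G\) if \(0<\alpha<\varepsilon(\mathcal F_{n-v})/\varepsilon(\mathcal F_{n-v-1})\), the bound being \(+\infty\) if \(\varepsilon(\mathcal F_{n-v-1})=0\). (A) For every such \(G\) and every admissible \(\alpha\),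 the matrix \(L+\alpha\bar J\) is invertible, and its inverse \(P=(p_{ij})\), the *accessibility via dense forests*, is a combination of \(Q_{n-v-1}\) and \(Q_{n-v}\) with positive coefficients, namely \[P=(L+\alpha\bar J)^{-1}=\frac1{\varepsilon(\mathcal F_{n-v})}\left(Q_{n-v-1}+\left(\alpha^{-1}-\frac{\varepsilon(\mathcal F_{n-v-1})}{\varepsilon(\mathcal F_{n-v})}\right)Q_{n-v}\right).\] Moreover, for all vertices \(i,j,k,t\): - symmetry: \(p_{ij}=p_{ji}\); - nonnegativity: \(p_{ij}\ge0\); - diagonal maximality: \(p_{ii}>p_{ij}\) and \(p_{ii}>p_{ji}\) if \(i\ne j\); - triangle inequality for proximities: \(p_{ij}+p_{ik}-p_{jk}\le p_{ii}\), strictly if \(j=k\ne i\); - disconnection condition: \(p_{ij}=0\) if and only if there is no path from \(i\) to \(j\) (there is a path of length \(0\) from each vertex to itself); - transit property: if there is a path from \(i\) to \(k\), \(i\ne k\ne t\), and every path from \(i\) to \(t\) includes \(k\), then \(p_{ik}>p_{it}\). (B) Accessibility via dense forests does not satisfy monotonicity. Here monotonicity is the requirement that, whenever the weight of an edge between distinct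 vertices \(k\) and \(t\) increases or a new edge between \(k\) and \(t\) is added, the increments \(\Delta p\) of the proximities satisfy: (1) \(\Delta p_{kt}>0\), and \(\Delta p_{kt}>\Delta p_{ij}\) whenever \(\{i,j\}\ne\{k,t\}\); (2) if there is a path from \(i\) to \(k\) and every path from \(i\) to \(t\) includes \(k\), then \(\Delta p_{it}>\Delta p_{ik}\); (3) if \(i_1\) and \(i_2\) both satisfy the hypothesis on \(i\) in (2), then \(p_{i_1i_2}\) does not increase. Precisely: - For every choice of an admissible \(\alpha(G)\) for each multigraph \(G\) on \(3\) vertices, each of the items (1), (2), (3) fails for the proximity measure \(G\mapsto(L+\alpha(G)\bar J)^{-1}\). - For every fixed \(\alpha>0\), items (1) and (3) fail for \(G\mapsto(L+\alpha\bar J)^{-1}\) on the class of multigraphs on \(3\) vertices for which \(\alpha\) is admissible. - Explicit example. Let \(G\) have the vertices \(1,2,3\) and one edge, joining \(1\) and \(2\), of weight \(1\); its admissible parameters are \(0<\alpha<2\). Let \(G'\) be obtained by adding an edge of weight \(w\) between \(k=1\) and \(t=3\). If \(\alpha\) is admissible for \(G\), \(\alpha'\) is admissible for \(G'\) and \(0<w\le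 2\alpha/3\), then the change from \((L(G)+\alpha\bar J(G))^{-1}\) to \((L(G')+\alpha'\bar J(G'))^{-1}\) violates each of (1), (2), (3). If a further edge between \(1\) and \(3\) (of any positive weight) is added to \(G'\) (with any \(w>0\)), then (1) is violated for every choice of admissible parameters of the two multigraphs, equal or not. -/

import Mathlib

universe u

/-- A finite weighted multigraph on the vertex set `V`: every edge has an unordered pair of ends
(parallel edges and loops are allowed) and a strictly positive weight. -/
structure WMultigraph (V : Type u) where
  Edge : Type
  [fintypeEdge : Fintype Edge]
  ends : Edge → Sym2 V
  weight : Edge → ℝ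
  weight_pos : ∀ e, 0 < weight e

attribute [instance] WMultigraph.fintypeEdge

namespace WMultigraph

variable {V : Type u}

/-- The adjacency structure of the spanning subgraph with edge set `F`. Loops are dropped and
parallel edges are merged, which changes neither the components nor the vertex sequences of
paths. -/
def spanning (G : WMultigraph V) (F : Set G.Edge) : SimpleGraph V :=
  SimpleGraph.fromEdgeSet (G.ends '' F)

/-- The adjacency structure of the whole multigraph. -/
def graph (G : WMultigraph V) : SimpleGraph V :=
  G.spanning Set.univ

/-- There is a path from `i` to `j` (for `i = j`: the path of length `0`). -/
def HasPath (G : WMultigraph V) (i j : V) : Prop :=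
  Nonempty (G.graph.Path i j)

/-- Every path from `i` to `t` includes the vertex `k`. -/
def AllPathsThrough (G : WMultigraph V) (i t k : V) : Prop :=
  ∀ p : G.graph.Path i t, k ∈ p.1.support

/-- The edge set `F` contains no cycle: no loop (cycle of length one), no two parallel edges
(cycle of length two) and no cycle of length at least three. -/
def IsAcyclicEdgeSet (G : WMultigraph V) (F : Set G.Edge) : Prop :=
  (∀ e ∈ F, ¬ (G.ends e).IsDiag) ∧ Set.InjOn G.ends F ∧ (G.spanning F).IsAcyclic

/-- `(F, R)` is a spanning rooted forest with edge set `F` and root set `R`: there are no cycles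
and every component of the spanning subgraph contains exactly one root. -/
def IsRootedForest (G : WMultigraph V) (F : Finset G.Edge) (R : Finset V) : Prop :=
  G.IsAcyclicEdgeSet (F : Set G.Edge) ∧
    ∀ x : V, ∃! r : V, r ∈ R ∧ (G.spanning (F : Set G.Edge)).Reachable r x

/-- The number `v` of connected components. -/
noncomputable def numComponents (G : WMultigraph V) : ℕ :=
  Nat.card G.graph.ConnectedComponent

section Finite

variable [Fintype V]

open Classical in
/-- The spanning rooted forests that consist of `k` edges; there are none if `k < 0`. -/
noncomputable def forests (G : WMultigraph V) (k : ℤ) : Finset (Finset G.Edge × Finset V) :=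
  Finset.univ.filter fun f => G.IsRootedForest f.1 f.2 ∧ (f.1.card : ℤ) = k

open Classical in
/-- The spanning rooted forests with `k` edges in which `j` belongs to the tree rooted at `i`. -/
noncomputable def forestsFromTo (G : WMultigraph V) (k : ℤ) (i j : V) :
    Finset (Finset G.Edge × Finset V) :=
  (G.forests k).filter fun f => i ∈ f.2 ∧ (G.spanning (f.1 : Set G.Edge)).Reachable i j

/-- The total weight of a set of rooted forests, the weight of one forest being the product of the
weights of its edges. -/
noncomputable def forestWeight (G : WMultigraph V)
    (S : Finset (Finset G.Edge × Finset V)) : ℝ :=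
  ∑ f ∈ S, ∏ e ∈ f.1, G.weight e

/-- The matrix `Q_k`. -/
noncomputable def Q (G : WMultigraph V) (k : ℤ) : Matrix V V ℝ :=
  Matrix.of fun i j => G.forestWeight (G.forestsFromTo k i j)

/-- The number `n - v`, the largest possible number of edges of a forest. -/
noncomputable def rank (G : WMultigraph V) : ℤ :=
  (Fintype.card V : ℤ) - (G.numComponents : ℤ)

/-- The matrix with `(i, j)` entry `1 / |V_i|` if `j` lies in the component `V_i` of `i`, and `0`
otherwise. -/
noncomputable def Jbar (G : WMultigraph V) : Matrix V V ℝ :=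
  open Classical in
  Matrix.of fun i j =>
    if G.graph.Reachable i j then 1 / (({x : V | G.graph.Reachable i x}.ncard : ℕ) : ℝ) else 0

variable [DecidableEq V]

/-- The total weight of the edges that connect `i` and `j`. -/
noncomputable def totalWeight (G : WMultigraph V) (i j : V) : ℝ :=
  ∑ e : G.Edge, if G.ends e = s(i, j) then G.weight e else 0

/-- The Laplacian matrix. -/
noncomputable def laplacian (G : WMultigraph V) : Matrix V V ℝ :=
  Matrix.of fun i j =>
    if i = j then ∑ x ∈ Finset.univ.erase i, G.totalWeight i x else - G.totalWeight i j

/-- `0 < α < ε(F_{n-v}) / ε(F_{n-v-1})`, the upper bound being `+∞` if `ε(F_{n-v-1}) = 0`, that is,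
if `G` has no edges other than loops. -/
def Admissible (G : WMultigraph V) (α : ℝ) : Prop :=
  0 < α ∧
    α * G.forestWeight (G.forests (G.rank - 1)) < G.forestWeight (G.forests G.rank)

/-- The matrix `(L + α J̄)⁻¹`; for admissible `α` it is the accessibility via dense forests. -/
noncomputable def accessibility (G : WMultigraph V) (α : ℝ) : Matrix V V ℝ :=
  (G.laplacian + α • G.Jbar)⁻¹

end Finite

/-! Normative properties of a proximity matrix `P` of a multigraph `G`. -/

/-- Symmetry. -/
def Symmetry (P : Matrix V V ℝ) : Prop :=
  ∀ i j, P i j = P j i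

/-- Nonnegativity. -/
def Nonnegativity (P : Matrix V V ℝ) : Prop :=
  ∀ i j, 0 ≤ P i j

/-- Diagonal maximality. -/
def DiagonalMaximality (P : Matrix V V ℝ) : Prop :=
  ∀ i j, i ≠ j → P i j < P i i ∧ P j i < P i i

/-- Triangle inequality for proximities. -/
def TriangleInequality (P : Matrix V V ℝ) : Prop :=
  ∀ i j k, P i j + P i k - P j k ≤ P i i ∧
    (j = k → i ≠ j → P i j + P i k - P j k < P i i)

/-- Disconnection condition. -/
def DisconnectionCondition (G : WMultigraph V) (P : Matrix V V ℝ) : Prop :=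
  ∀ i j, P i j = 0 ↔ ¬ G.HasPath i j

/-- Transit property. -/
def TransitProperty (G : WMultigraph V) (P : Matrix V V ℝ) : Prop :=
  ∀ i k t, G.HasPath i k → i ≠ k → k ≠ t → G.AllPathsThrough i t k → P i t < P i k

/-! Monotonicity. -/

open Classical in
/-- The multigraph with the weight of the edge `e` replaced by `w`. -/
noncomputable def reweight (G : WMultigraph V) (e : G.Edge) (w : ℝ) (hw : 0 < w) :
    WMultigraph V where
  Edge := G.Edge
  ends := G.ends
  weight := Function.update G.weight e w
  weight_pos := by
    intro x
    by_cases h : x = e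
    · subst h
      simpa using hw
    · simpa [Function.update_of_ne h] using G.weight_pos x

/-- The multigraph with a new edge of weight `w` between `k` and `t`. -/
def addEdge (G : WMultigraph V) (k t : V) (w : ℝ) (hw : 0 < w) : WMultigraph V where
  Edge := Option G.Edge
  ends := fun e => e.elim s(k, t) G.ends
  weight := fun e => e.elim w G.weight
  weight_pos := by
    intro e
    cases e with
    | none => exact hw
    | some e => exact G.weight_pos e

/-- `Strengthens k t G G'`: `G'` results from `G` by increasing the weight of some edge between `k`
and `t`, or by adding a new edge between `k` and `t`. -/
inductive Strengthens (k t : V) : WMultigraph V → WMultigraph V → Prop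
  | increase (G : WMultigraph V) (e : G.Edge) (he : G.ends e = s(k, t)) (w : ℝ) (hw : 0 < w)
      (hlt : G.weight e < w) : Strengthens k t G (G.reweight e w hw)
  | new (G : WMultigraph V) (w : ℝ) (hw : 0 < w) : Strengthens k t G (G.addEdge k t w hw)

/-- Item 1 of monotonicity for one change, `P` and `P'` being the proximities before and after. -/
def Item1 (_G : WMultigraph V) (P P' : Matrix V V ℝ) (k t : V) : Prop :=
  0 < (P' - P) k t ∧ ∀ i j, s(i, j) ≠ s(k, t) → (P' - P) i j < (P' - P) k t

/-- Item 2 of monotonicity for one change. -/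
def Item2 (G : WMultigraph V) (P P' : Matrix V V ℝ) (k t : V) : Prop :=
  ∀ i, G.HasPath i k → G.AllPathsThrough i t k → (P' - P) i k < (P' - P) i t

/-- Item 3 of monotonicity for one change. -/
def Item3 (G : WMultigraph V) (P P' : Matrix V V ℝ) (k t : V) : Prop :=
  ∀ i₁ i₂, G.HasPath i₁ k → G.AllPathsThrough i₁ t k →
    G.HasPath i₂ k → G.AllPathsThrough i₂ t k → P' i₁ i₂ ≤ P i₁ i₂

/-- The proximity measure `P`, considered on the class `C` of multigraphs, satisfies the given item
of monotonicity for every strengthening of the bond between two distinct vertices that stays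
within the class. -/
def MonotoneOn
    (item : WMultigraph V → Matrix V V ℝ → Matrix V V ℝ → V → V → Prop)
    (C : Set (WMultigraph V)) (P : WMultigraph V → Matrix V V ℝ) : Prop :=
  ∀ G ∈ C, ∀ G' ∈ C, ∀ k t : V, k ≠ t → Strengthens k t G G' → item G (P G) (P G') k t

/-- The multigraph on three vertices with exactly one edge, which joins the vertices `0` and `1`
and has weight one. -/
def oneEdge : WMultigraph (Fin 3) where
  Edge := Unit
  ends := fun _ => s(0, 1)
  weight := fun _ => 1
  weight_pos := fun _ => one_pos

end WMultigraph

/-! ### Reachability after the addition of one edge. -/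

namespace SimpleGraph

variable {V : Type u}

/-! The representation rests on the recurrence `Q_{k+1} + Q_k L = ε(F_{k+1}) I`
(`Q_succ_add_Q_mul_laplacian`). Its off-diagonal entries come from a surgery: a forest in which `i`
is no root arises in exactly one way by hanging a tree rooted at `i` onto a vertex of another tree
(`sum_forests_succ`). Starting from `Q_{-1} = 0`, the recurrence makes every `Q_k` a polynomial in
`L`, hence symmetric. No forest has more than `n - v` edges, so `L Q_{n-v} = 0`; the columns of
`Q_{n-v}` are therefore constant on components, and `Q_{n-v} = ε(F_{n-v}) J̄` (`Q_rank_eq`). With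
`J̄ Q_k = ε(F_k) J̄` this verifies the inverse by multiplication and yields `L P = I - J̄`.

Nonnegativity and the disconnection condition are read off the positive coefficients. By `L P = I -
J̄`, column `i` of `P` is strictly subharmonic on the component of `i` away from `i`. The maximum
principle (`lt_of_subharmonic`) then gives diagonal maximality, the triangle inequality and the
transit property.

For the counterexamples, traces of the recurrence give the small forest matrices without
enumeration. In a connected graph the parameter adds the same constant to every entry, so
comparisons of increments within a chain do not depend on it. If `t` is isolated, the path
hypothesis of (2) and (3) is vacuous, and joining `t` by an edge of small weight `w` raises
proximities inside the old component by a term of order `1/w`. -/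

theorem reachable_sup_edge_iff {H : SimpleGraph V} {i x a b : V} :
    (H ⊔ edge i x).Reachable a b ↔ H.Reachable a b ∨ (H.Reachable a i ∧ H.Reachable x b) ∨
      (H.Reachable a x ∧ H.Reachable i b) := by
  constructor
  · rintro ⟨p⟩
    induction p with
    | nil => exact Or.inl (Reachable.refl _)
    | cons h p ih =>
      rw [sup_adj, edge_adj] at h
      rcases h with h | ⟨⟨rfl, rfl⟩ | ⟨rfl, rfl⟩, -⟩
      · have h' := h.reachable
        rcases ih with ih | ih | ih
        · exact Or.inl (h'.trans ih)
        · exact Or.inr (Or.inl ⟨h'.trans ih.1, ih.2⟩)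
        · exact Or.inr (Or.inr ⟨h'.trans ih.1, ih.2⟩)
      · rcases ih with ih | ih | ih
        · exact Or.inr (Or.inl ⟨Reachable.refl _, ih⟩)
        · exact Or.inr (Or.inl ⟨Reachable.refl _, ih.2⟩)
        · exact Or.inl ih.2
      · rcases ih with ih | ih | ih
        · exact Or.inr (Or.inr ⟨Reachable.refl _, ih⟩)
        · exact Or.inl ih.2
        · exact Or.inr (Or.inr ⟨Reachable.refl _, ih.2⟩)
  · have hix : (H ⊔ edge i x).Reachable i x := by
      by_cases h : i = x
      · exact h ▸ Reachable.refl _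
      · exact Adj.reachable (by rw [sup_adj, edge_adj]; tauto)
    have hle : H ≤ H ⊔ edge i x := le_sup_left
    rintro (h | ⟨h₁, h₂⟩ | ⟨h₁, h₂⟩)
    · exact h.mono hle
    · exact (h₁.mono hle).trans (hix.trans (h₂.mono hle))
    · exact (h₁.mono hle).trans (hix.symm.trans (h₂.mono hle))

end SimpleGraph

/-! ### Acyclic edge sets and surgery on rooted forests. -/

namespace WMultigraph

open SimpleGraph

variable {V : Type u} (G : WMultigraph V)

theorem spanning_mono {F F' : Set G.Edge} (h : F ⊆ F') : G.spanning F ≤ G.spanning F' :=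
  fromEdgeSet_mono (Set.image_mono h)

theorem spanning_adj {F : Set G.Edge} {a b : V} :
    (G.spanning F).Adj a b ↔ (∃ e ∈ F, G.ends e = s(a, b)) ∧ a ≠ b := by
  simp [spanning]

theorem reachable_of_mem {F : Set G.Edge} {e : G.Edge} {i x : V} (he : e ∈ F)
    (hx : G.ends e = s(i, x)) : (G.spanning F).Reachable i x := by
  by_cases h : i = x
  · exact h ▸ Reachable.refl _
  · exact Adj.reachable (G.spanning_adj.2 ⟨⟨e, he, hx⟩, h⟩)

variable {G}

theorem spanning_insert {F : Set G.Edge} {e : G.Edge} {i x : V} (hx : G.ends e = s(i, x)) :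
    G.spanning (insert e F) = G.spanning F ⊔ edge i x := by
  ext a b
  rw [sup_adj, edge_adj, spanning_adj, spanning_adj]
  simp only [Set.mem_insert_iff, exists_eq_or_imp, hx, Sym2.eq_iff]
  grind

theorem reachable_spanning_insert {F : Set G.Edge} {e : G.Edge} {i x : V}
    (hx : G.ends e = s(i, x)) {a b : V} :
    (G.spanning (insert e F)).Reachable a b ↔ (G.spanning F).Reachable a b ∨
      ((G.spanning F).Reachable a i ∧ (G.spanning F).Reachable x b) ∨
      ((G.spanning F).Reachable a x ∧ (G.spanning F).Reachable i b) := by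
  rw [spanning_insert hx, reachable_sup_edge_iff]

theorem IsAcyclicEdgeSet.mono {F F' : Set G.Edge} (h : G.IsAcyclicEdgeSet F') (hF : F ⊆ F') :
    G.IsAcyclicEdgeSet F :=
  ⟨fun e he => h.1 e (hF he), h.2.1.mono hF, h.2.2.anti (G.spanning_mono hF)⟩

theorem IsAcyclicEdgeSet.insert_edge {F : Set G.Edge} (h : G.IsAcyclicEdgeSet F) {e : G.Edge}
    {i x : V} (hx : G.ends e = s(i, x)) (hr : ¬ (G.spanning F).Reachable i x) :
    G.IsAcyclicEdgeSet (insert e F) := by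
  refine ⟨?_, ?_, ?_⟩
  · rintro f (rfl | hf)
    · rw [hx, Sym2.mk_isDiag_iff]
      rintro rfl
      exact hr (Reachable.refl _)
    · exact h.1 f hf
  · rintro f (rfl | hf) g (rfl | hg) hfg
    · rfl
    · exact absurd (G.reachable_of_mem hg (hfg.symm.trans hx)) hr
    · exact absurd (G.reachable_of_mem hf (hfg.trans hx)) hr
    · exact h.2.1 hf hg hfg
  · rw [spanning_insert hx]
    exact h.2.2.sup_edge_of_not_reachable hr

theorem IsAcyclicEdgeSet.not_reachable {F : Set G.Edge} {e : G.Edge} {i x : V}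
    (h : G.IsAcyclicEdgeSet (insert e F)) (he : e ∉ F) (hx : G.ends e = s(i, x)) :
    ¬ (G.spanning F).Reachable i x := by
  intro hr
  have h1 := h.2.2
  -- An edge between connected vertices keeps the simple graph acyclic only if it is degenerate or
  -- already present. These cases are a loop and a pair of parallel edges, which the other two
  -- clauses of acyclicity exclude.
  rw [spanning_insert hx, isAcyclic_sup_fromEdgeSet_iff] at h1
  rcases h1.2 hr with h2 | h2
  · refine h.1 e (Set.mem_insert _ _) ?_
    rw [hx, h2]
    exact Sym2.mk_isDiag_iff.2 rfl
  · obtain ⟨⟨f, hf, hfe⟩, -⟩ := G.spanning_adj.1 h2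
    exact he (h.2.1 (Set.mem_insert_of_mem _ hf) (Set.mem_insert _ _) (hfe.trans hx.symm) ▸ hf)

/-- A vertex different from the root of its component has an edge towards the root. -/
theorem exists_parent {F : Set G.Edge} {r i : V} (h : (G.spanning F).Reachable r i) (hne : r ≠ i) :
    ∃ e ∈ F, ∃ x, G.ends e = s(i, x) ∧ (G.spanning (F \ {e})).Reachable r x := by
  classical
  obtain ⟨p, hp⟩ := h.symm.exists_isPath
  cases p with
  | nil => exact absurd rfl hne
  | @cons _ x _ hadj p =>
    obtain ⟨⟨e, he, hx⟩, -⟩ := G.spanning_adj.1 hadj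
    refine ⟨e, he, x, hx, ?_⟩
    -- The rest of the path does not return to `i`, so it cannot use `e` and survives the removal of
    -- `e`.
    have hi := ((Walk.cons_isPath_iff _ _).1 hp).2
    refine (Reachable.symm ⟨p.transfer _ fun d hd => ?_⟩)
    have hd' := p.edges_subset_edgeSet hd
    simp only [spanning, edgeSet_fromEdgeSet] at hd' ⊢
    obtain ⟨⟨f, hf, rfl⟩, hdiag⟩ := hd'
    refine ⟨⟨f, ⟨hf, ?_⟩, rfl⟩, hdiag⟩
    rintro rfl
    rw [hx] at hd
    exact hi (p.fst_mem_support_of_mem_edges hd)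

theorem IsRootedForest.root_unique {F : Finset G.Edge} {R : Finset V} (h : G.IsRootedForest F R)
    {r r' x : V} (hr : r ∈ R) (hr' : r' ∈ R) (hx : (G.spanning (F : Set G.Edge)).Reachable r x)
    (hx' : (G.spanning (F : Set G.Edge)).Reachable r' x) : r = r' :=
  (h.2 x).unique ⟨hr, hx⟩ ⟨hr', hx'⟩

variable [DecidableEq G.Edge]

/-- This is the injectivity of the surgery: the edge to cut at `i` must be the one towards the root
of `i`. If `e ≠ e'`, follow `F` from the root of `x` to `x`. A connection avoiding `e'` lies in
`F'`, where `e` extends it to `i`, so that root is `i`; one using `e'` ties `x` to `i` inside `F`.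
Both contradict `hr`. -/
theorem IsRootedForest.detach_edge_unique {F F' : Finset G.Edge} {R : Finset V}
    (h' : G.IsRootedForest F' R) {i x x' : V} {e e' : G.Edge} (hi : i ∈ R)
    (hx : G.ends e = s(i, x)) (hx' : G.ends e' = s(i, x'))
    (h : G.IsRootedForest F R)
    (hr : ¬ (G.spanning (F : Set G.Edge)).Reachable i x) (hFF : insert e F = insert e' F') :
    e = e' := by
  by_contra hne
  have heF' : e ∈ F' := by
    have : e ∈ insert e' F' := hFF ▸ Finset.mem_insert_self _ _
    exact (Finset.mem_insert.1 this).resolve_left hne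
  have heF : e' ∈ F := by
    have : e' ∈ insert e F := hFF ▸ Finset.mem_insert_self _ _
    exact (Finset.mem_insert.1 this).resolve_left (Ne.symm hne)
  have hsub : ((F.erase e' : Finset G.Edge) : Set G.Edge) ⊆ F' := by
    intro f hf
    obtain ⟨hf1, hf2⟩ := Finset.mem_erase.1 (Finset.mem_coe.1 hf)
    have : f ∈ insert e' F' := hFF ▸ Finset.mem_insert_of_mem hf2
    exact (Finset.mem_insert.1 this).resolve_left hf1
  obtain ⟨q, ⟨hqR, hqx⟩, -⟩ := h.2 x
  have hF : (F : Set G.Edge) = insert e' ((F.erase e' : Finset G.Edge) : Set G.Edge) := by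
    rw [← Finset.coe_insert, Finset.insert_erase heF]
  have hto : ∀ {a b}, (G.spanning ((F.erase e' : Finset G.Edge) : Set G.Edge)).Reachable a b →
      (G.spanning (F : Set G.Edge)).Reachable a b :=
    fun hab => hab.mono (G.spanning_mono (by simp))
  have hix' : (G.spanning (F : Set G.Edge)).Reachable i x' :=
    G.reachable_of_mem (Finset.mem_coe.2 heF) hx'
  rw [hF] at hqx
  rcases (reachable_spanning_insert hx').1 hqx with h1 | ⟨-, h1⟩ | ⟨-, h1⟩
  · have h2 : (G.spanning (F' : Set G.Edge)).Reachable q i :=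
      (h1.mono (G.spanning_mono hsub)).trans
        (G.reachable_of_mem (Finset.mem_coe.2 heF') hx).symm
    have : q = i := h'.root_unique hqR hi h2 (Reachable.refl _)
    subst this
    exact hr (hto h1)
  · exact hr (hix'.trans (hto h1))
  · exact hr (hto h1)

variable [DecidableEq V]

/-- Hanging the tree rooted at `i` onto a vertex `x` of another tree. -/
theorem IsRootedForest.attach {F : Finset G.Edge} {R : Finset V} (h : G.IsRootedForest F R)
    {i x : V} {e : G.Edge} (hi : i ∈ R) (hx : G.ends e = s(i, x))
    (hr : ¬ (G.spanning (F : Set G.Edge)).Reachable i x) :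
    G.IsRootedForest (insert e F) (R.erase i) := by
  refine ⟨by rw [Finset.coe_insert]; exact h.1.insert_edge hx hr, fun y => ?_⟩
  rw [Finset.coe_insert]
  obtain ⟨r, ⟨hrR, hry⟩, -⟩ := h.2 y
  obtain ⟨q, ⟨hqR, hqx⟩, -⟩ := h.2 x
  have hqi : q ≠ i := by rintro rfl; exact hr hqx
  -- Vertices of the tree of `i` pass to the root `q` of `x`; all others keep their root.
  by_cases hri : r = i
  · subst hri
    refine ⟨q, ⟨Finset.mem_erase.2 ⟨hqi, hqR⟩,
      (reachable_spanning_insert hx).2 (Or.inr (Or.inr ⟨hqx, hry⟩))⟩, ?_⟩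
    rintro s ⟨hs, hsy⟩
    obtain ⟨hsi, hsR⟩ := Finset.mem_erase.1 hs
    rcases (reachable_spanning_insert hx).1 hsy with h1 | ⟨h1, -⟩ | ⟨h1, -⟩
    · exact absurd (h.root_unique hsR hi h1 hry) hsi
    · exact absurd (h.root_unique hsR hi h1 (Reachable.refl _)) hsi
    · exact h.root_unique hsR hqR h1 hqx
  · refine ⟨r, ⟨Finset.mem_erase.2 ⟨hri, hrR⟩, (reachable_spanning_insert hx).2 (Or.inl hry)⟩, ?_⟩
    rintro s ⟨hs, hsy⟩
    obtain ⟨hsi, hsR⟩ := Finset.mem_erase.1 hs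
    rcases (reachable_spanning_insert hx).1 hsy with h1 | ⟨h1, -⟩ | ⟨-, h1⟩
    · exact h.root_unique hsR hrR h1 hry
    · exact absurd (h.root_unique hsR hi h1 (Reachable.refl _)) hsi
    · exact absurd (h.root_unique hrR hi hry h1) hri

/-- Cutting the edge from a vertex `i` that is no root towards the root of `i`. -/
theorem IsRootedForest.exists_detach {F : Finset G.Edge} {R : Finset V} (h : G.IsRootedForest F R)
    {i : V} (hi : i ∉ R) :
    ∃ e ∈ F, ∃ x, G.ends e = s(i, x) ∧
      ¬ (G.spanning ((F.erase e : Finset G.Edge) : Set G.Edge)).Reachable i x ∧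
      G.IsRootedForest (F.erase e) (insert i R) := by
  obtain ⟨r, ⟨hrR, hri⟩, -⟩ := h.2 i
  obtain ⟨e, he, x, hx, hrx⟩ := exists_parent hri (by rintro rfl; exact hi hrR)
  have hF : (F : Set G.Edge) = insert e ((F.erase e : Finset G.Edge) : Set G.Edge) := by
    rw [← Finset.coe_insert, Finset.insert_erase he]
  rw [show (F : Set G.Edge) \ {e} = ((F.erase e : Finset G.Edge) : Set G.Edge) by simp] at hrx
  have hac := h.1
  rw [hF] at hac
  have hnr := hac.not_reachable (by simp) hx
  refine ⟨e, he, x, hx, hnr, hac.mono (Set.subset_insert _ _), fun y => ?_⟩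
  have hto : ∀ {a b}, (G.spanning ((F.erase e : Finset G.Edge) : Set G.Edge)).Reachable a b →
      (G.spanning (F : Set G.Edge)).Reachable a b :=
    fun hab => hab.mono (G.spanning_mono (by simp))
  -- After the cut no old root reaches `i`: it could only be `r`, which still reaches `x`, and then
  -- `i` and `x` would still be connected.
  have hni : ∀ s ∈ R, ¬ (G.spanning ((F.erase e : Finset G.Edge) : Set G.Edge)).Reachable s i := by
    intro s hs hsi
    have : s = r := h.root_unique hs hrR (hto hsi) hri
    subst this
    exact hnr (hsi.symm.trans hrx)
  obtain ⟨q, ⟨hqR, hqy⟩, -⟩ := h.2 y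
  rw [hF] at hqy
  rcases (reachable_spanning_insert hx).1 hqy with h1 | ⟨h1, -⟩ | ⟨-, h1⟩
  · refine ⟨q, ⟨Finset.mem_insert_of_mem hqR, h1⟩, ?_⟩
    rintro s ⟨hs, hsy⟩
    rcases Finset.mem_insert.1 hs with rfl | hs
    · exact absurd (h1.trans hsy.symm) (hni q hqR)
    · exact h.root_unique hs hqR (hto hsy) (hto h1)
  · exact absurd h1 (hni q hqR)
  · refine ⟨i, ⟨Finset.mem_insert_self _ _, h1⟩, ?_⟩
    rintro s ⟨hs, hsy⟩
    rcases Finset.mem_insert.1 hs with rfl | hs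
    · rfl
    · exact absurd (hsy.trans h1.symm) (hni s hs)

end WMultigraph

namespace WMultigraph

open SimpleGraph

/-! ### The recurrence for the forest matrices -/

variable {V : Type u} (G : WMultigraph V)

/-- The product of the weights of the edges of a forest. -/
noncomputable def edgeProd (f : Finset G.Edge × Finset V) : ℝ :=
  ∏ e ∈ f.1, G.weight e

theorem edgeProd_pos (f : Finset G.Edge × Finset V) : 0 < G.edgeProd f :=
  Finset.prod_pos fun e _ => G.weight_pos e

open Classical in
/-- The indicator of `x` belonging to the tree rooted at `j`. -/
noncomputable def rootInd (f : Finset G.Edge × Finset V) (j x : V) : ℝ :=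
  if j ∈ f.2 ∧ (G.spanning (f.1 : Set G.Edge)).Reachable j x then 1 else 0

open Classical in
/-- The indicator of `x` not being connected to `i` in a forest. -/
noncomputable def sepInd (f : Finset G.Edge × Finset V) (i x : V) : ℝ :=
  if (G.spanning (f.1 : Set G.Edge)).Reachable i x then 0 else 1

variable {G}

theorem IsRootedForest.rootInd_eq_zero {f : Finset G.Edge × Finset V}
    (h : G.IsRootedForest f.1 f.2) {i j x : V} (hi : i ∈ f.2) (hij : j ≠ i)
    (hx : (G.spanning (f.1 : Set G.Edge)).Reachable i x) : G.rootInd f j x = 0 := by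
  rw [rootInd, if_neg]
  rintro ⟨hj, hjx⟩
  exact hij (h.root_unique hj hi hjx hx)

theorem forestWeight_nonneg (S : Finset (Finset G.Edge × Finset V)) : 0 ≤ G.forestWeight S :=
  Finset.sum_nonneg fun f _ => (G.edgeProd_pos f).le

section

variable [DecidableEq V]

theorem totalWeight_comm (i j : V) : G.totalWeight i j = G.totalWeight j i := by
  simp only [totalWeight, Sym2.eq_swap]

theorem totalWeight_nonneg (i j : V) : 0 ≤ G.totalWeight i j :=
  Finset.sum_nonneg fun e _ => by split_ifs; exacts [(G.weight_pos e).le, le_rfl]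

theorem graph_adj_iff {i j : V} : G.graph.Adj i j ↔ 0 < G.totalWeight i j ∧ i ≠ j := by
  rw [graph, spanning_adj]
  refine and_congr_left fun _ => ⟨?_, fun h => ?_⟩
  · rintro ⟨e, -, he⟩
    exact Finset.sum_pos' (fun e _ => by split_ifs; exacts [(G.weight_pos e).le, le_rfl])
      ⟨e, Finset.mem_univ _, by rw [if_pos he]; exact G.weight_pos e⟩
  · obtain ⟨e, -, he⟩ := Finset.exists_ne_zero_of_sum_ne_zero h.ne'
    exact ⟨e, Set.mem_univ _, by by_contra hne; exact he (if_neg hne)⟩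

theorem reachable_of_totalWeight_ne_zero {i j : V} (h : G.totalWeight i j ≠ 0) :
    G.graph.Reachable i j := by
  by_cases hij : i = j
  · exact hij ▸ Reachable.refl _
  · exact (graph_adj_iff.2 ⟨(totalWeight_nonneg i j).lt_of_ne' h, hij⟩).reachable

end

variable [Fintype V] (G)

theorem mem_forests {k : ℤ} {f : Finset G.Edge × Finset V} :
    f ∈ G.forests k ↔ G.IsRootedForest f.1 f.2 ∧ (f.1.card : ℤ) = k := by
  simp [forests]

variable {G}

theorem Q_apply (k : ℤ) (j x : V) :
    G.Q k j x = ∑ f ∈ G.forests k, G.edgeProd f * G.rootInd f j x := by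
  classical
  simp only [Q, Matrix.of_apply, forestWeight, forestsFromTo, Finset.sum_filter, edgeProd, rootInd]
  exact Finset.sum_congr rfl fun f _ => by split_ifs <;> simp

theorem forestWeight_forests (k : ℤ) :
    G.forestWeight (G.forests k) = ∑ f ∈ G.forests k, G.edgeProd f := rfl

theorem Q_nonneg (k : ℤ) (i j : V) : 0 ≤ G.Q k i j :=
  forestWeight_nonneg _

theorem IsRootedForest.sum_rootInd {f : Finset G.Edge × Finset V} (h : G.IsRootedForest f.1 f.2)
    (x : V) : ∑ j, G.rootInd f j x = 1 := by
  classical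
  obtain ⟨r, hr, hu⟩ := h.2 x
  rw [Finset.sum_eq_single r]
  · simp [rootInd, hr]
  · intro j _ hj
    rw [rootInd, if_neg fun h => hj (hu j h)]
  · simp

/-- Every vertex lies in exactly one tree, so each forest is counted once in a column sum. -/
theorem sum_Q (k : ℤ) (x : V) : ∑ j, G.Q k j x = G.forestWeight (G.forests k) := by
  simp only [Q_apply]
  rw [Finset.sum_comm, forestWeight_forests]
  refine Finset.sum_congr rfl fun f hf => ?_
  rw [← Finset.mul_sum, (G.mem_forests.1 hf).1.sum_rootInd, mul_one]

variable [DecidableEq V]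

theorem laplacian_isSymm : G.laplacian.transpose = G.laplacian := by
  ext i j
  simp only [Matrix.transpose_apply, laplacian, Matrix.of_apply]
  by_cases h : i = j
  · subst h; rfl
  · rw [if_neg h, if_neg (Ne.symm h), totalWeight_comm]

/-- The rows of `L` sum to zero, so `L` acts by differences. The term `z = i` vanishes, so the total
weight of the loops at `i` does no harm. The recurrence, the energy identity and the maximum
principle all use this form. -/
theorem laplacian_mul_apply (M : Matrix V V ℝ) (i j : V) :
    (G.laplacian * M) i j = ∑ z, G.totalWeight i z * (M i j - M z j) := by
  rw [Matrix.mul_apply, ← Finset.add_sum_erase _ _ (Finset.mem_univ i),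
    ← Finset.add_sum_erase (a := i) _ (fun z => G.totalWeight i z * (M i j - M z j))
      (Finset.mem_univ i)]
  simp only [laplacian, Matrix.of_apply, if_true, sub_self, mul_zero, zero_add]
  rw [Finset.sum_mul, ← Finset.sum_add_distrib]
  refine Finset.sum_congr rfl fun z hz => ?_
  rw [if_neg (Finset.ne_of_mem_erase hz).symm]
  ring

theorem mul_laplacian_apply (M : Matrix V V ℝ) (j i : V) :
    (M * G.laplacian) j i = ∑ z, G.totalWeight i z * (M j i - M j z) := by
  have h : (M * G.laplacian) j i = (G.laplacian * M.transpose) i j := by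
    rw [← Matrix.transpose_apply (G.laplacian * M.transpose), Matrix.transpose_mul,
      Matrix.transpose_transpose, laplacian_isSymm]
  rw [h, laplacian_mul_apply]
  rfl

open Classical in
/-- Rooted forests in which `i` is no root arise from those in which `i` is a root by hanging the
tree rooted at `i` onto another tree. -/
theorem sum_forests_succ (k : ℤ) (i : V) (Φ : Finset G.Edge × Finset V → ℝ) :
    ∑ f ∈ G.forests (k + 1) with i ∉ f.2, Φ f =
      ∑ f ∈ G.forests k with i ∈ f.2, ∑ x, ∑ e,
        if G.ends e = s(i, x) ∧ ¬ (G.spanning (f.1 : Set G.Edge)).Reachable i x then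
          Φ (insert e f.1, f.2.erase i) else 0 := by
  have hrhs : ∀ f : Finset G.Edge × Finset V, ∑ x, ∑ e,
        (if G.ends e = s(i, x) ∧ ¬ (G.spanning (f.1 : Set G.Edge)).Reachable i x then
          Φ (insert e f.1, f.2.erase i) else 0) =
      ∑ p : V × G.Edge with G.ends p.2 = s(i, p.1) ∧
        ¬ (G.spanning (f.1 : Set G.Edge)).Reachable i p.1,
          Φ (insert p.2 f.1, f.2.erase i) := by
    intro f
    rw [Finset.sum_filter, Fintype.sum_prod_type]
  simp only [hrhs]
  rw [Finset.sum_sigma']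
  symm
  refine Finset.sum_bij (fun q _ => (insert q.2.2 q.1.1, q.1.2.erase i)) ?_ ?_ ?_ (fun _ _ => rfl)
  · rintro ⟨⟨F, R⟩, x, e⟩ hq
    simp only [Finset.mem_sigma, Finset.mem_filter, Finset.mem_univ, true_and, mem_forests] at hq ⊢
    obtain ⟨⟨⟨hf, hk⟩, hi⟩, hx, hr⟩ := hq
    refine ⟨⟨hf.attach hi hx hr, ?_⟩, by simp⟩
    rw [Finset.card_insert_of_notMem fun he => hr (G.reachable_of_mem (Finset.mem_coe.2 he) hx)]
    push_cast
    rw [hk]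
  · rintro ⟨⟨F, R⟩, x, e⟩ hq ⟨⟨F', R'⟩, x', e'⟩ hq' heq
    simp only [Finset.mem_sigma, Finset.mem_filter, Finset.mem_univ, true_and, mem_forests]
      at hq hq'
    obtain ⟨⟨⟨hf, -⟩, hi⟩, hx, hr⟩ := hq
    obtain ⟨⟨⟨hf', -⟩, hi'⟩, hx', hr'⟩ := hq'
    simp only [Prod.mk.injEq] at heq
    -- The data are recovered in the order root set, edge, vertex `x`, edge set.
    have hR : R = R' := by rw [← Finset.insert_erase hi, heq.2, Finset.insert_erase hi']
    subst hR
    have he := hf'.detach_edge_unique hi hx hx' hf hr heq.1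
    subst he
    have hxx : x = x' := Sym2.congr_right.1 (hx.symm.trans hx')
    subst hxx
    have heF : e ∉ F := fun he => hr (G.reachable_of_mem (Finset.mem_coe.2 he) hx)
    have heF' : e ∉ F' := fun he => hr' (G.reachable_of_mem (Finset.mem_coe.2 he) hx)
    have hF : F = F' := by
      rw [← Finset.erase_insert heF, heq.1, Finset.erase_insert heF']
    subst hF
    rfl
  · rintro ⟨F, R⟩ hq
    simp only [Finset.mem_filter, mem_forests] at hq
    obtain ⟨⟨hf, hk⟩, hi⟩ := hq
    obtain ⟨e, he, x, hx, hr, hf'⟩ := hf.exists_detach hi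
    refine ⟨⟨(F.erase e, insert i R), x, e⟩, ?_, ?_⟩
    · simp only [Finset.mem_sigma, Finset.mem_filter, Finset.mem_univ, true_and, mem_forests]
      refine ⟨⟨⟨hf', ?_⟩, Finset.mem_insert_self _ _⟩, hx, hr⟩
      have := Finset.card_erase_add_one he
      omega
    · simp [Finset.insert_erase he, Finset.erase_insert hi]

open Classical in
-- Vertices of the tree of `i` inherit the root of `x`, all others keep theirs. One summand vanishes
-- in each case: the second because `i`, not `j`, is the old root, the first because `sepInd` is
-- `1`.
theorem IsRootedForest.rootInd_attach {f : Finset G.Edge × Finset V}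
    (h : G.IsRootedForest f.1 f.2) {i j x : V} {e : G.Edge} (hi : i ∈ f.2) (hij : j ≠ i)
    (hx : G.ends e = s(i, x)) (z : V) :
    G.rootInd (insert e f.1, f.2.erase i) j z =
      (1 - G.sepInd f i z) * G.rootInd f j x + G.rootInd f j z := by
  have hji : j ∈ f.2 → ¬ (G.spanning (f.1 : Set G.Edge)).Reachable j i := fun hj hr =>
    hij (h.root_unique hj hi hr (Reachable.refl _))
  by_cases hz : (G.spanning (f.1 : Set G.Edge)).Reachable i z
  · have hjz : j ∈ f.2 → ¬ (G.spanning (f.1 : Set G.Edge)).Reachable j z := fun hj hr =>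
      hij (h.root_unique hj hi hr hz)
    rw [h.rootInd_eq_zero hi hij hz]
    simp only [rootInd, sepInd, Finset.coe_insert, reachable_spanning_insert hx, hz, if_true,
      Finset.mem_erase]
    have : ((j ≠ i ∧ j ∈ f.2) ∧ ((G.spanning (f.1 : Set G.Edge)).Reachable j z ∨
        (G.spanning (f.1 : Set G.Edge)).Reachable j i ∧
          (G.spanning (f.1 : Set G.Edge)).Reachable x z ∨
        (G.spanning (f.1 : Set G.Edge)).Reachable j x ∧ True)) ↔
        (j ∈ f.2 ∧ (G.spanning (f.1 : Set G.Edge)).Reachable j x) := by tauto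
    simp only [this]
    split_ifs <;> simp
  · simp only [rootInd, sepInd, Finset.coe_insert, reachable_spanning_insert hx, hz, if_false,
      Finset.mem_erase]
    have : ((j ≠ i ∧ j ∈ f.2) ∧ ((G.spanning (f.1 : Set G.Edge)).Reachable j z ∨
        (G.spanning (f.1 : Set G.Edge)).Reachable j i ∧
          (G.spanning (f.1 : Set G.Edge)).Reachable x z ∨
        (G.spanning (f.1 : Set G.Edge)).Reachable j x ∧ False)) ↔
        (j ∈ f.2 ∧ (G.spanning (f.1 : Set G.Edge)).Reachable j z) := by tauto
    simp only [this]
    split_ifs <;> simp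

open Classical in
theorem sum_rootInd_not_root (k : ℤ) {i j : V} (hij : j ≠ i) (z : V) :
    ∑ f ∈ G.forests (k + 1) with i ∉ f.2, G.edgeProd f * G.rootInd f j z =
      ∑ f ∈ G.forests k with i ∈ f.2, G.edgeProd f * ∑ x, G.totalWeight i x *
        ((1 - G.sepInd f i z) * G.rootInd f j x + G.sepInd f i x * G.rootInd f j z) := by
  rw [sum_forests_succ]
  refine Finset.sum_congr rfl fun f hf => ?_
  rw [Finset.mem_filter, mem_forests] at hf
  obtain ⟨⟨h, -⟩, hi⟩ := hf
  rw [Finset.mul_sum]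
  refine Finset.sum_congr rfl fun x _ => ?_
  rw [totalWeight, Finset.sum_mul, Finset.mul_sum]
  refine Finset.sum_congr rfl fun e _ => ?_
  by_cases hx : G.ends e = s(i, x)
  -- For `x` in the tree of `i` nothing may be attached, and the summand on the right vanishes too:
  -- both `rootInd f j x` and `sepInd f i x` are zero.
  · by_cases hr : (G.spanning (f.1 : Set G.Edge)).Reachable i x
    · rw [if_neg (by tauto), h.rootInd_eq_zero hi hij hr]
      simp [sepInd, hr]
    · have he : e ∉ f.1 := fun he => hr (G.reachable_of_mem (Finset.mem_coe.2 he) hx)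
      rw [if_pos ⟨hx, hr⟩, if_pos hx, h.rootInd_attach hi hij hx, edgeProd,
        Finset.prod_insert he, edgeProd, show G.sepInd f i x = 1 by simp [sepInd, hr]]
      ring
  · rw [if_neg (by tauto), if_neg hx]
    ring

/-- The forests with `k` edges are split by whether `i` is a root. Those rooted at `i` contribute
`-Q_{k+1}(j, i)` to the Laplacian sum, by one surgery. The others come by surgery from forests with
`k - 1` edges and cancel. -/
theorem Q_succ_apply_of_ne (k : ℤ) {i j : V} (hij : j ≠ i) :
    G.Q (k + 1) j i + ∑ z, G.totalWeight i z * (G.Q k j i - G.Q k j z) = 0 := by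
  classical
  have h1 : G.Q (k + 1) j i =
      ∑ f ∈ G.forests k with i ∈ f.2, G.edgeProd f * ∑ x, G.totalWeight i x * G.rootInd f j x := by
    rw [Q_apply, ← Finset.sum_filter_add_sum_filter_not _ (fun f => i ∈ f.2),
      sum_rootInd_not_root k hij, Finset.sum_eq_zero, zero_add]
    · refine Finset.sum_congr rfl fun f hf => ?_
      rw [Finset.mem_filter, mem_forests] at hf
      rw [hf.1.1.rootInd_eq_zero hf.2 hij (Reachable.refl _),
        show G.sepInd f i i = 0 by simp [sepInd]]
      simp
    · intro f hf
      rw [Finset.mem_filter, mem_forests] at hf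
      rw [hf.1.1.rootInd_eq_zero hf.2 hij (Reachable.refl _), mul_zero]
  have h2 : ∑ z, G.totalWeight i z * (G.Q k j i - G.Q k j z) =
      ∑ f ∈ G.forests k, G.edgeProd f *
        ∑ z, G.totalWeight i z * (G.rootInd f j i - G.rootInd f j z) := by
    simp only [Q_apply, ← Finset.sum_sub_distrib, Finset.mul_sum]
    rw [Finset.sum_comm]
    refine Finset.sum_congr rfl fun f _ => Finset.sum_congr rfl fun z _ => by ring
  have h3 : ∑ f ∈ G.forests k with i ∈ f.2, G.edgeProd f *
        ∑ z, G.totalWeight i z * (G.rootInd f j i - G.rootInd f j z) = - G.Q (k + 1) j i := by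
    rw [h1, ← Finset.sum_neg_distrib]
    refine Finset.sum_congr rfl fun f hf => ?_
    rw [Finset.mem_filter, mem_forests] at hf
    rw [hf.1.1.rootInd_eq_zero hf.2 hij (Reachable.refl _), ← mul_neg, ← Finset.sum_neg_distrib]
    congr 1
    exact Finset.sum_congr rfl fun z _ => by ring
  have h4 : ∑ f ∈ G.forests k with i ∉ f.2, G.edgeProd f *
        ∑ z, G.totalWeight i z * (G.rootInd f j i - G.rootInd f j z) = 0 := by
    have h5 : ∑ f ∈ G.forests k with i ∉ f.2, G.edgeProd f *
          ∑ z, G.totalWeight i z * (G.rootInd f j i - G.rootInd f j z) =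
        ∑ z, G.totalWeight i z *
          (∑ f ∈ G.forests (k - 1 + 1) with i ∉ f.2, G.edgeProd f * G.rootInd f j i -
            ∑ f ∈ G.forests (k - 1 + 1) with i ∉ f.2, G.edgeProd f * G.rootInd f j z) := by
      simp only [sub_add_cancel, ← Finset.sum_sub_distrib, Finset.mul_sum]
      rw [Finset.sum_comm]
      refine Finset.sum_congr rfl fun f _ => Finset.sum_congr rfl fun z _ => by ring
    rw [h5]
    simp only [sum_rootInd_not_root (k - 1) hij, ← Finset.sum_sub_distrib, Finset.mul_sum]
    rw [Finset.sum_comm]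
    refine Finset.sum_eq_zero fun f hf => ?_
    rw [Finset.mem_filter, mem_forests] at hf
    obtain ⟨⟨h, -⟩, hi⟩ := hf
    have hs : G.sepInd f i i = 0 := by simp [sepInd]
    have hi0 := h.rootInd_eq_zero hi hij (Reachable.refl i)
    -- Each summand is antisymmetric under the exchange of `z` and `x`, so the double sum is zero.
    have h6 : ∀ z x : V, G.totalWeight i z *
        (G.edgeProd f * (G.totalWeight i x * ((1 - G.sepInd f i i) * G.rootInd f j x +
            G.sepInd f i x * G.rootInd f j i)) -
          G.edgeProd f * (G.totalWeight i x * ((1 - G.sepInd f i z) * G.rootInd f j x +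
            G.sepInd f i x * G.rootInd f j z))) =
        G.edgeProd f * (G.totalWeight i z * G.totalWeight i x *
          (G.sepInd f i z * G.rootInd f j x)) -
        G.edgeProd f * (G.totalWeight i x * G.totalWeight i z *
          (G.sepInd f i x * G.rootInd f j z)) := by
      intro z x
      rw [hs, hi0]
      ring
    simp only [h6, Finset.sum_sub_distrib]
    rw [sub_eq_zero, Finset.sum_comm]
  rw [h2, ← Finset.sum_filter_add_sum_filter_not _ (fun f => i ∈ f.2), h3, h4]
  ring

/-- The recurrence `Q_{k+1} + Q_k L = ε(F_{k+1}) I`. -/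
theorem Q_succ_add_Q_mul_laplacian (k : ℤ) :
    G.Q (k + 1) + G.Q k * G.laplacian =
      G.forestWeight (G.forests (k + 1)) • (1 : Matrix V V ℝ) := by
  ext j i
  rw [Matrix.add_apply, mul_laplacian_apply, Matrix.smul_apply, Matrix.one_apply]
  by_cases hij : j = i
  · subst hij
    -- The diagonal entry needs no surgery. The columns of `Q_k` have equal sums, so the Laplacian
    -- part drops out of the column sum of the left side; as the off-diagonal entries vanish, the
    -- diagonal one is `ε(F_{k+1})`.
    have hsum : ∑ l, (G.Q (k + 1) l j + ∑ z, G.totalWeight j z * (G.Q k l j - G.Q k l z)) =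
        G.forestWeight (G.forests (k + 1)) := by
      rw [Finset.sum_add_distrib, sum_Q, Finset.sum_comm]
      simp only [← Finset.mul_sum, Finset.sum_sub_distrib, sum_Q, sub_self, mul_zero,
        Finset.sum_const_zero, add_zero]
    rw [Finset.sum_eq_single j (fun l _ hl => Q_succ_apply_of_ne k hl) (by simp)] at hsum
    simp [hsum]
  · rw [Q_succ_apply_of_ne k hij]
    simp [hij]

end WMultigraph

namespace WMultigraph

open SimpleGraph

/-! ### The inverse of `L + α J̄` -/

variable {V : Type u} {G : WMultigraph V}

theorem hasPath_iff {i j : V} : G.HasPath i j ↔ G.graph.Reachable i j := by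
  classical
  exact ⟨fun ⟨p⟩ => ⟨p.1⟩, fun ⟨p⟩ => ⟨p.toPath⟩⟩

theorem reachable_graph {F : Set G.Edge} {i j : V} (h : (G.spanning F).Reachable i j) :
    G.graph.Reachable i j :=
  h.mono (G.spanning_mono (Set.subset_univ _))

variable [Fintype V]

/-- Each cut trades one edge for one root. A cut is possible while edges remain, since an edge
between two roots would have to be a loop; without edges every vertex is a root. -/
theorem IsRootedForest.card_add_card {F : Finset G.Edge} {R : Finset V}
    (h : G.IsRootedForest F R) : F.card + R.card = Fintype.card V := by
  classical
  induction hm : F.card generalizing F R with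
  | zero =>
    rw [Finset.card_eq_zero] at hm
    subst hm
    have : R = Finset.univ := by
      refine Finset.eq_univ_of_forall fun x => ?_
      obtain ⟨r, ⟨hr, hrx⟩, -⟩ := h.2 x
      rw [Finset.coe_empty, spanning, Set.image_empty, fromEdgeSet_empty, reachable_bot] at hrx
      exact hrx ▸ hr
    rw [this, Finset.card_univ, zero_add]
  | succ m ih =>
    have hi : ∃ i, i ∉ R := by
      by_contra! hall
      obtain ⟨e, he⟩ := Finset.card_pos.1 (by omega : 0 < F.card)
      refine h.1.1 e (Finset.mem_coe.2 he) ?_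
      induction hx : G.ends e with
      | _ a b =>
        exact Sym2.mk_isDiag_iff.2 (h.root_unique (hall a) (hall b)
          (G.reachable_of_mem (Finset.mem_coe.2 he) hx) (Reachable.refl _))
    obtain ⟨i, hi⟩ := hi
    obtain ⟨e, he, x, -, -, h'⟩ := h.exists_detach hi
    have h1 := ih h' (by rw [Finset.card_erase_of_mem he]; omega)
    rw [Finset.card_insert_of_notMem hi] at h1
    omega

theorem IsRootedForest.numComponents_le {F : Finset G.Edge} {R : Finset V}
    (h : G.IsRootedForest F R) : G.numComponents ≤ R.card := by
  rw [numComponents, show R.card = Nat.card (R : Set V) by simp]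
  refine Nat.card_le_card_of_surjective
    (fun r : (R : Set V) => G.graph.connectedComponentMk r.1) fun c => ?_
  induction c using ConnectedComponent.ind with
  | h x =>
    obtain ⟨r, ⟨hr, hrx⟩, -⟩ := h.2 x
    exact ⟨⟨r, hr⟩, ConnectedComponent.sound (reachable_graph hrx)⟩

theorem forests_eq_empty_of_rank_lt {k : ℤ} (hk : G.rank < k) : G.forests k = ∅ := by
  refine Finset.eq_empty_of_forall_notMem fun f hf => ?_
  obtain ⟨h, hc⟩ := G.mem_forests.1 hf
  have h1 := h.card_add_card
  have h2 := h.numComponents_le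
  rw [rank] at hk
  omega

theorem forests_eq_empty_of_neg {k : ℤ} (hk : k < 0) : G.forests k = ∅ := by
  refine Finset.eq_empty_of_forall_notMem fun f hf => ?_
  obtain ⟨h, hc⟩ := G.mem_forests.1 hf
  omega

theorem Q_eq_zero_of_forests_eq_empty {k : ℤ} (hk : G.forests k = ∅) : G.Q k = 0 := by
  ext i j
  simp [Q_apply, hk]

theorem Q_eq_zero_of_not_reachable (k : ℤ) {i j : V} (h : ¬ G.graph.Reachable i j) :
    G.Q k i j = 0 := by
  rw [Q_apply]
  refine Finset.sum_eq_zero fun f _ => ?_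
  rw [rootInd, if_neg fun hr => h (reachable_graph hr.2), mul_zero]

/-- A forest with `k` edges has `n - k` roots and is counted once for each. -/
theorem trace_Q (k : ℤ) :
    (G.Q k).trace = ((Fintype.card V : ℝ) - k) * G.forestWeight (G.forests k) := by
  classical
  simp only [Matrix.trace, Matrix.diag_apply, Q_apply]
  rw [Finset.sum_comm, forestWeight_forests, Finset.mul_sum]
  refine Finset.sum_congr rfl fun f hf => ?_
  obtain ⟨h, hc⟩ := G.mem_forests.1 hf
  rw [← Finset.mul_sum, mul_comm]
  congr 1
  have h1 : ((f.1.card : ℝ)) + f.2.card = Fintype.card V := by exact_mod_cast h.card_add_card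
  have h2 : ((f.1.card : ℝ)) = k := by exact_mod_cast hc
  have h3 : ∀ i, G.rootInd f i i = if i ∈ f.2 then 1 else 0 := fun i => by simp [rootInd]
  simp only [h3]
  rw [Finset.sum_boole, Finset.filter_univ_mem]
  linarith

theorem Jbar_congr_right {i j k : V} (h : G.graph.Reachable j k) : G.Jbar i j = G.Jbar i k := by
  simp only [Jbar, Matrix.of_apply]
  by_cases hij : G.graph.Reachable i j
  · rw [if_pos hij, if_pos (hij.trans h)]
  · rw [if_neg hij, if_neg fun hik => hij (hik.trans h.symm)]

theorem Jbar_pos {i j : V} (h : G.graph.Reachable i j) : 0 < G.Jbar i j := by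
  simp only [Jbar, Matrix.of_apply]
  rw [if_pos h]
  have : 0 < {x : V | G.graph.Reachable i x}.ncard :=
    (Set.ncard_pos (Set.toFinite _)).2 ⟨i, Reachable.refl _⟩
  positivity

theorem Jbar_eq_zero {i j : V} (h : ¬ G.graph.Reachable i j) : G.Jbar i j = 0 := by
  simp only [Jbar, Matrix.of_apply]
  rw [if_neg h]

/-- The strict inequality in admissibility already forces positivity, so no spanning forest has to
be constructed. -/
theorem Admissible.forestWeight_pos {α : ℝ} (h : G.Admissible α) :
    0 < G.forestWeight (G.forests G.rank) :=
  lt_of_le_of_lt (mul_nonneg h.1.le (forestWeight_nonneg _)) h.2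

theorem Admissible.coeff_pos {α : ℝ} (h : G.Admissible α) :
    0 < α⁻¹ - G.forestWeight (G.forests (G.rank - 1)) / G.forestWeight (G.forests G.rank) := by
  rw [sub_pos, div_lt_iff₀ h.forestWeight_pos, inv_mul_eq_div, lt_div_iff₀ h.1, mul_comm]
  exact h.2

variable [DecidableEq V]

/-- Symmetry and commutation with `L` must be carried together: the recurrence expresses `Q_{k+1}`
through `Q_k L`, which is symmetric only if the factors commute. No re-rooting bijection is needed.
-/
theorem Q_isSymm_and_commute (n : ℕ) :
    (G.Q n).transpose = G.Q n ∧ G.Q n * G.laplacian = G.laplacian * G.Q n := by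
  have key : ∀ k : ℤ, (G.Q k).transpose = G.Q k ∧
      G.Q k * G.laplacian = G.laplacian * G.Q k → (G.Q (k + 1)).transpose = G.Q (k + 1) ∧
      G.Q (k + 1) * G.laplacian = G.laplacian * G.Q (k + 1) := by
    rintro k ⟨h1, h2⟩
    rw [eq_sub_of_add_eq (Q_succ_add_Q_mul_laplacian (G := G) k)]
    constructor
    · rw [Matrix.transpose_sub, Matrix.transpose_smul, Matrix.transpose_one, Matrix.transpose_mul,
        laplacian_isSymm, h1, h2]
    · rw [sub_mul, mul_sub, Matrix.smul_mul, Matrix.mul_smul, one_mul, mul_one, ← mul_assoc, h2]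
  induction n with
  | zero =>
    -- The induction starts one step early, at `Q_{-1} = 0`.
    have := key (-1) (by
      rw [Q_eq_zero_of_forests_eq_empty (forests_eq_empty_of_neg (by norm_num))]
      simp)
    simpa using this
  | succ n ih => exact_mod_cast key n ih

theorem Q_transpose (k : ℤ) : (G.Q k).transpose = G.Q k := by
  rcases lt_or_ge k 0 with hk | hk
  · rw [Q_eq_zero_of_forests_eq_empty (forests_eq_empty_of_neg hk), Matrix.transpose_zero]
  · lift k to ℕ using hk
    exact (Q_isSymm_and_commute k).1

theorem Q_comm (k : ℤ) (i j : V) : G.Q k i j = G.Q k j i :=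
  congrFun (congrFun (Q_transpose k).symm i) j

theorem Q_succ_add_laplacian_mul_Q (k : ℤ) :
    G.Q (k + 1) + G.laplacian * G.Q k =
      G.forestWeight (G.forests (k + 1)) • (1 : Matrix V V ℝ) := by
  have h := congrArg Matrix.transpose (Q_succ_add_Q_mul_laplacian (G := G) k)
  rwa [Matrix.transpose_add, Matrix.transpose_mul, laplacian_isSymm, Q_transpose, Q_transpose,
    Matrix.transpose_smul, Matrix.transpose_one] at h

/-- The trace of the recurrence, with `n ε(F_{k+1}) - (n - k - 1) ε(F_{k+1})` collected. Alternating
it with the recurrence produces all `Q_k` from `L`. -/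
theorem succ_mul_forestWeight (k : ℤ) :
    ((k : ℝ) + 1) * G.forestWeight (G.forests (k + 1)) = (G.Q k * G.laplacian).trace := by
  have h := congrArg Matrix.trace (Q_succ_add_Q_mul_laplacian (G := G) k)
  rw [Matrix.trace_add, trace_Q, Matrix.trace_smul, Matrix.trace_one, smul_eq_mul] at h
  push_cast at h
  linarith

theorem laplacian_mul_Q_rank : G.laplacian * G.Q G.rank = 0 := by
  have h := Q_succ_add_laplacian_mul_Q (G := G) G.rank
  rw [Q_eq_zero_of_forests_eq_empty (forests_eq_empty_of_rank_lt (by omega)),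
    forests_eq_empty_of_rank_lt (by omega), forestWeight, Finset.sum_empty, zero_smul,
    zero_add] at h
  exact h

/-- Functions in the kernel of the Laplacian are constant on the components. -/
theorem eq_of_reachable_of_laplacian {f : V → ℝ}
    (hf : ∀ x, ∑ z, G.totalWeight x z * (f x - f z) = 0) {i j : V} (h : G.graph.Reachable i j) :
    f i = f j := by
  -- The energy identity: the sum over ordered pairs is twice the sum of `f x * (L f) x`, hence
  -- zero, and all its terms are nonnegative.
  have h1 : ∑ x, ∑ z, G.totalWeight x z * (f x - f z) ^ 2 = 0 := by
    have ha : ∑ x, ∑ z, f x * (G.totalWeight x z * (f x - f z)) = 0 := by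
      simp only [← Finset.mul_sum, hf, mul_zero, Finset.sum_const_zero]
    have hb := ha
    rw [Finset.sum_comm] at hb
    have hab := congrArg₂ (· + ·) ha hb
    simp only [← Finset.sum_add_distrib, add_zero] at hab
    rw [← hab]
    refine Finset.sum_congr rfl fun x _ => Finset.sum_congr rfl fun z _ => ?_
    rw [totalWeight_comm z x]
    ring
  have hnn : ∀ x z, 0 ≤ G.totalWeight x z * (f x - f z) ^ 2 := fun x z =>
    mul_nonneg (totalWeight_nonneg x z) (sq_nonneg _)
  have hadj : ∀ x z, G.graph.Adj x z → f x = f z := by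
    intro x z hxz
    have h2 := (Finset.sum_eq_zero_iff_of_nonneg
      (fun x _ => Finset.sum_nonneg fun z _ => hnn x z)).1 h1 x (Finset.mem_univ _)
    have h3 := (Finset.sum_eq_zero_iff_of_nonneg (fun z _ => hnn x z)).1 h2 z (Finset.mem_univ _)
    rcases mul_eq_zero.1 h3 with h4 | h4
    · exact absurd h4 (graph_adj_iff.1 hxz).1.ne'
    · exact sub_eq_zero.1 (pow_eq_zero_iff two_ne_zero |>.1 h4)
  obtain ⟨p⟩ := h
  induction p with
  | nil => rfl
  | cons h _ ih => exact (hadj _ _ h).trans ih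

/-- Column `j` is killed by `L`, hence constant on the component of `j`; it vanishes elsewhere and
sums to `ε(F_{n-v})`. -/
theorem Q_rank_eq : G.Q G.rank = G.forestWeight (G.forests G.rank) • G.Jbar := by
  classical
  ext i j
  rw [Matrix.smul_apply, Jbar, Matrix.of_apply, smul_eq_mul]
  by_cases hij : G.graph.Reachable i j
  · rw [if_pos hij, mul_one_div]
    have hset : {x : V | G.graph.Reachable i x}.ncard ≠ 0 :=
      (Set.ncard_pos (Set.toFinite _)).2 ⟨i, Reachable.refl _⟩ |>.ne'
    rw [eq_div_iff (by exact_mod_cast hset)]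
    have hconst : ∀ x, G.graph.Reachable i x → G.Q G.rank x j = G.Q G.rank i j := by
      intro x hx
      refine (eq_of_reachable_of_laplacian (f := fun y => G.Q G.rank y j) (fun y => ?_) hx).symm
      rw [← laplacian_mul_apply, laplacian_mul_Q_rank, Matrix.zero_apply]
    rw [← sum_Q G.rank j, ← Finset.sum_filter_add_sum_filter_not _ (fun x => G.graph.Reachable i x),
      Finset.sum_congr rfl fun x hx => hconst x (Finset.mem_filter.1 hx).2,
      Finset.sum_eq_zero (s := Finset.univ.filter fun x => ¬ G.graph.Reachable i x)]
    · rw [Finset.sum_const, add_zero, nsmul_eq_mul, mul_comm, Set.ncard_eq_toFinset_card']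
      congr 3
      ext x
      simp
    · intro x hx
      exact Q_eq_zero_of_not_reachable _ fun h => (Finset.mem_filter.1 hx).2 (hij.trans h.symm)
  · rw [if_neg hij, mul_zero, Q_eq_zero_of_not_reachable _ hij]

theorem Jbar_mul_Q (k : ℤ) : G.Jbar * G.Q k = G.forestWeight (G.forests k) • G.Jbar := by
  ext i j
  rw [Matrix.mul_apply, Matrix.smul_apply, smul_eq_mul, ← sum_Q k j, Finset.sum_mul]
  refine Finset.sum_congr rfl fun x _ => ?_
  by_cases h : G.graph.Reachable x j
  · rw [Jbar_congr_right h, mul_comm]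
  · rw [Q_eq_zero_of_not_reachable k h, zero_mul, mul_zero]

theorem Admissible.mul_eq_one {α : ℝ} (h : G.Admissible α) :
    (G.laplacian + α • G.Jbar) * ((1 / G.forestWeight (G.forests G.rank)) • G.Q (G.rank - 1) +
      (1 / G.forestWeight (G.forests G.rank) *
        (α⁻¹ - G.forestWeight (G.forests (G.rank - 1)) / G.forestWeight (G.forests G.rank))) •
        G.Q G.rank) = 1 := by
  have h1 : G.laplacian * G.Q (G.rank - 1) =
      G.forestWeight (G.forests G.rank) • (1 : Matrix V V ℝ) - G.Q G.rank := by
    have := Q_succ_add_laplacian_mul_Q (G := G) (G.rank - 1)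
    rw [sub_add_cancel] at this
    exact eq_sub_of_add_eq' this
  have hα := h.1.ne'
  have hε := h.forestWeight_pos.ne'
  simp only [mul_add, add_mul, Matrix.mul_smul, Matrix.smul_mul, h1, laplacian_mul_Q_rank,
    Jbar_mul_Q]
  rw [Q_rank_eq]
  ext i j
  simp only [Matrix.add_apply, Matrix.smul_apply, Matrix.sub_apply, Matrix.zero_apply, smul_eq_mul]
  field_simp
  ring

theorem Admissible.isUnit {α : ℝ} (h : G.Admissible α) : IsUnit (G.laplacian + α • G.Jbar) :=
  IsUnit.of_mul_eq_one _ h.mul_eq_one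

theorem Admissible.accessibility_eq {α : ℝ} (h : G.Admissible α) :
    G.accessibility α = (1 / G.forestWeight (G.forests G.rank)) • G.Q (G.rank - 1) +
      (1 / G.forestWeight (G.forests G.rank) *
        (α⁻¹ - G.forestWeight (G.forests (G.rank - 1)) / G.forestWeight (G.forests G.rank))) •
        G.Q G.rank :=
  Matrix.inv_eq_right_inv h.mul_eq_one

/-- The parameter disappears, because it only multiplies `J̄`, which `L` annihilates. The right side
is negative off the diagonal within a component, which feeds the maximum principle. -/
theorem Admissible.laplacian_mul_accessibility {α : ℝ} (h : G.Admissible α) :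
    G.laplacian * G.accessibility α = 1 - G.Jbar := by
  have h1 : G.laplacian * G.Q (G.rank - 1) =
      G.forestWeight (G.forests G.rank) • (1 : Matrix V V ℝ) - G.Q G.rank := by
    have := Q_succ_add_laplacian_mul_Q (G := G) (G.rank - 1)
    rw [sub_add_cancel] at this
    exact eq_sub_of_add_eq' this
  have hε := h.forestWeight_pos.ne'
  rw [h.accessibility_eq, mul_add, Matrix.mul_smul, Matrix.mul_smul, h1, laplacian_mul_Q_rank,
    Q_rank_eq]
  ext i j
  simp only [Matrix.add_apply, Matrix.smul_apply, Matrix.sub_apply, Matrix.zero_apply, smul_eq_mul]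
  field_simp
  ring

/-! ### The normative properties -/

theorem Admissible.symmetry {α : ℝ} (h : G.Admissible α) : Symmetry (G.accessibility α) := by
  intro i j
  simp only [h.accessibility_eq, Matrix.add_apply, Matrix.smul_apply, Q_comm _ i j]

theorem Admissible.nonnegativity {α : ℝ} (h : G.Admissible α) :
    Nonnegativity (G.accessibility α) := by
  intro i j
  have h1 := h.forestWeight_pos
  have h2 := h.coeff_pos
  have h3 := Q_nonneg (G := G) (G.rank - 1) i j
  have h4 := Q_nonneg (G := G) G.rank i j
  simp only [h.accessibility_eq, Matrix.add_apply, Matrix.smul_apply, smul_eq_mul]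
  positivity

theorem Admissible.accessibility_pos {α : ℝ} (h : G.Admissible α) {i j : V}
    (hij : G.graph.Reachable i j) : 0 < G.accessibility α i j := by
  have h1 := h.forestWeight_pos
  have h2 := h.coeff_pos
  have h3 := Q_nonneg (G := G) (G.rank - 1) i j
  have h4 := Jbar_pos hij
  simp only [h.accessibility_eq, Matrix.add_apply, Matrix.smul_apply, Q_rank_eq, smul_eq_mul]
  positivity

theorem Admissible.accessibility_eq_zero {α : ℝ} (h : G.Admissible α) {i j : V}
    (hij : ¬ G.graph.Reachable i j) : G.accessibility α i j = 0 := by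
  simp only [h.accessibility_eq, Matrix.add_apply, Matrix.smul_apply,
    Q_eq_zero_of_not_reachable _ hij, smul_zero, add_zero]

theorem Admissible.disconnectionCondition {α : ℝ} (h : G.Admissible α) :
    DisconnectionCondition G (G.accessibility α) := by
  intro i j
  rw [hasPath_iff]
  exact ⟨fun h0 hij => (h.accessibility_pos hij).ne' h0, h.accessibility_eq_zero⟩

/-- The maximum principle: a function that is strictly subharmonic on a set of vertices is there
less than at the only vertex outside to which the set is joined. -/
theorem lt_of_subharmonic {f : V → ℝ} {S : Finset V} {b : V}
    (hf : ∀ x ∈ S, ∑ z, G.totalWeight x z * (f x - f z) < 0)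
    (hS : ∀ x ∈ S, ∀ z, G.totalWeight x z ≠ 0 → z ∈ S ∨ z = b) {x : V} (hx : x ∈ S) :
    f x < f b := by
  obtain ⟨m, hm, hmax⟩ := S.exists_max_image f ⟨x, hx⟩
  refine (hmax x hx).trans_lt ?_
  by_contra! hb
  refine (hf m hm).not_ge (Finset.sum_nonneg fun z _ => ?_)
  by_cases hz : G.totalWeight m z = 0
  · rw [hz, zero_mul]
  · refine mul_nonneg (totalWeight_nonneg m z) (sub_nonneg.2 ?_)
    rcases hS m hm z hz with h | rfl
    · exact hmax z h
    · exact hb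

open Classical in
theorem lt_of_subharmonic_on_component {f : V → ℝ} {i : V}
    (hf : ∀ x, G.graph.Reachable i x → x ≠ i → ∑ z, G.totalWeight x z * (f x - f z) < 0) {x : V}
    (hx : G.graph.Reachable i x) (hne : x ≠ i) : f x < f i := by
  refine lt_of_subharmonic (G := G)
    (S := Finset.univ.filter fun y => G.graph.Reachable i y ∧ y ≠ i) ?_ ?_ (by simp [hx, hne])
  · intro y hy
    simp only [Finset.mem_filter, Finset.mem_univ, true_and] at hy
    exact hf y hy.1 hy.2
  · intro y hy z hz
    simp only [Finset.mem_filter, Finset.mem_univ, true_and] at hy ⊢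
    by_cases hzi : z = i
    · exact Or.inr hzi
    · exact Or.inl ⟨hy.1.trans (reachable_of_totalWeight_ne_zero hz), hzi⟩

theorem Admissible.sum_totalWeight_mul {α : ℝ} (h : G.Admissible α) (i x : V) :
    ∑ z, G.totalWeight x z * (G.accessibility α x i - G.accessibility α z i) =
      (1 : Matrix V V ℝ) x i - G.Jbar x i := by
  rw [← laplacian_mul_apply, h.laplacian_mul_accessibility, Matrix.sub_apply]

theorem Admissible.lt_diag {α : ℝ} (h : G.Admissible α) {i j : V} (hij : i ≠ j) :
    G.accessibility α j i < G.accessibility α i i := by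
  by_cases hr : G.graph.Reachable i j
  · refine lt_of_subharmonic_on_component (f := fun x => G.accessibility α x i) ?_ hr hij.symm
    intro x hx hne
    rw [h.sum_totalWeight_mul, Matrix.one_apply_ne hne, zero_sub, neg_lt_zero]
    exact Jbar_pos hx.symm
  · rw [h.accessibility_eq_zero fun hr' => hr hr'.symm]
    exact h.accessibility_pos (Reachable.refl _)

theorem Admissible.diagonalMaximality {α : ℝ} (h : G.Admissible α) :
    DiagonalMaximality (G.accessibility α) := fun i j hij =>
  ⟨h.symmetry i j ▸ h.lt_diag hij, h.lt_diag hij⟩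

theorem Admissible.triangleInequality {α : ℝ} (h : G.Admissible α) :
    TriangleInequality (G.accessibility α) := by
  intro i j k
  have hsymm := h.symmetry
  refine ⟨?_, ?_⟩
  · by_cases hki : k = i
    · subst hki
      rw [hsymm j k]
      linarith
    by_cases hr : G.graph.Reachable i k
    · rw [hsymm i k, hsymm j k]
      -- The case `δ = 0` is the claim, but there the function need not be strictly subharmonic: if
      -- `j` is in the component of `i`, the two `J̄` terms cancel. The extra multiple of column `i`
      -- restores strictness.
      have hδ : ∀ δ : ℝ, 0 < δ → (1 + δ) * G.accessibility α k i - G.accessibility α k j <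
          (1 + δ) * G.accessibility α i i - G.accessibility α i j := by
        intro δ hδ
        refine lt_of_subharmonic_on_component
          (f := fun x => (1 + δ) * G.accessibility α x i - G.accessibility α x j) ?_ hr hki
        intro x hx hne
        have hsum : ∑ z, G.totalWeight x z *
            (((1 + δ) * G.accessibility α x i - G.accessibility α x j) -
              ((1 + δ) * G.accessibility α z i - G.accessibility α z j)) =
            (1 + δ) * ((1 : Matrix V V ℝ) x i - G.Jbar x i) -
              ((1 : Matrix V V ℝ) x j - G.Jbar x j) := by
          rw [← h.sum_totalWeight_mul, ← h.sum_totalWeight_mul, Finset.mul_sum,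
            ← Finset.sum_sub_distrib]
          exact Finset.sum_congr rfl fun z _ => by ring
        rw [hsum, Matrix.one_apply_ne hne]
        have h1 : 0 ≤ (1 : Matrix V V ℝ) x j := by
          rw [Matrix.one_apply]
          split_ifs <;> norm_num
        have h2 : G.Jbar x j ≤ G.Jbar x i := by
          by_cases hxj : G.graph.Reachable x j
          · exact (Jbar_congr_right (hxj.symm.trans hx.symm)).le
          · rw [Jbar_eq_zero hxj]
            exact (Jbar_pos hx.symm).le
        have h3 := mul_pos hδ (Jbar_pos hx.symm)
        linarith
      have hd : 0 < G.accessibility α i i - G.accessibility α k i :=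
        sub_pos.2 (h.lt_diag (Ne.symm hki))
      by_contra! hlt
      -- This `δ` makes the gain `δ (p_ii - p_ik)` equal to the supposed excess, which the strict
      -- inequality forbids.
      have h4 := hδ ((G.accessibility α i j + G.accessibility α k i - G.accessibility α k j -
        G.accessibility α i i) / (G.accessibility α i i - G.accessibility α k i))
        (div_pos (by linarith) hd)
      have h5 := div_mul_cancel₀ (G.accessibility α i j + G.accessibility α k i -
        G.accessibility α k j - G.accessibility α i i) hd.ne'
      linarith
    · rw [h.accessibility_eq_zero hr]
      have h1 := h.nonnegativity j k
      have h2 : G.accessibility α i j ≤ G.accessibility α i i := by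
        by_cases hij : i = j
        · rw [hij]
        · exact (h.diagonalMaximality i j hij).1.le
      linarith
  · rintro rfl hij
    have h1 := (h.diagonalMaximality i j hij).1
    have h2 := (h.diagonalMaximality j i hij.symm).2
    linarith

open Classical in
theorem Admissible.transitProperty {α : ℝ} (h : G.Admissible α) :
    TransitProperty G (G.accessibility α) := by
  intro i k t hik hne hkt hall
  rw [hasPath_iff] at hik
  by_cases hit : G.graph.Reachable i t
  swap
  · rw [h.accessibility_eq_zero hit]
    exact h.accessibility_pos hik
  rw [h.symmetry i t, h.symmetry i k]
  -- The set consists of the vertices that `t` reaches without meeting `k`. It omits `i` by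
  -- hypothesis, and only `k` is adjacent to it from outside.
  refine lt_of_subharmonic (G := G) (f := fun x => G.accessibility α x i) (b := k)
    (S := Finset.univ.filter fun x => ∃ p : G.graph.Walk t x, k ∉ p.support) ?_ ?_ ?_
  · intro x hx
    simp only [Finset.mem_filter, Finset.mem_univ, true_and] at hx
    obtain ⟨p, hp⟩ := hx
    have hxi : x ≠ i := by
      rintro rfl
      have hk := hall p.reverse.toPath
      have := Walk.support_toPath_subset_support _ hk
      rw [Walk.support_reverse, List.mem_reverse] at this
      exact hp this
    rw [h.sum_totalWeight_mul, Matrix.one_apply_ne hxi, zero_sub, neg_lt_zero]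
    exact Jbar_pos (hit.trans ⟨p⟩).symm
  · intro x hx z hz
    simp only [Finset.mem_filter, Finset.mem_univ, true_and] at hx ⊢
    obtain ⟨p, hp⟩ := hx
    by_cases hzk : z = k
    · exact Or.inr hzk
    refine Or.inl ?_
    by_cases hxz : x = z
    · exact hxz ▸ ⟨p, hp⟩
    · have hadj : G.graph.Adj x z :=
        graph_adj_iff.2 ⟨(totalWeight_nonneg x z).lt_of_ne' hz, hxz⟩
      exact ⟨p.concat hadj, by simp [Walk.support_concat, hp, Ne.symm hzk]⟩
  · simp only [Finset.mem_filter, Finset.mem_univ, true_and]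
    exact ⟨Walk.nil, by simpa using hkt⟩

end WMultigraph

namespace WMultigraph

open SimpleGraph

/-! ### Forest matrices with few edges -/

section

variable {V : Type u} {G : WMultigraph V}

theorem totalWeight_addEdge [DecidableEq V] (k t : V) (w : ℝ) (hw : 0 < w) (i j : V) :
    (G.addEdge k t w hw).totalWeight i j =
      (if s(k, t) = s(i, j) then w else 0) + G.totalWeight i j :=
  Fintype.sum_option _

variable [Fintype V]

/-- Bounds the rank from below without counting components; a crude lower bound on their number
gives the rest. -/
theorem le_rank_of_forestWeight_pos {k : ℤ} (h : 0 < G.forestWeight (G.forests k)) :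
    k ≤ G.rank := by
  by_contra! hk
  rw [forests_eq_empty_of_rank_lt hk, forestWeight, Finset.sum_empty] at h
  exact h.false

theorem forestWeight_forests_zero : G.forestWeight (G.forests 0) = 1 := by
  have : G.forests 0 = {(∅, Finset.univ)} := by
    ext ⟨F, R⟩
    rw [mem_forests, Finset.mem_singleton, Prod.mk.injEq]
    constructor
    · rintro ⟨h, hc⟩
      have hF : F = ∅ := by
        rw [← Finset.card_eq_zero]
        exact_mod_cast hc
      have h1 := h.card_add_card
      subst hF
      exact ⟨rfl, Finset.card_eq_iff_eq_univ R |>.1 (by simpa using h1)⟩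
    · rintro ⟨rfl, rfl⟩
      refine ⟨⟨?_, fun x => ⟨x, by simp, ?_⟩⟩, by simp⟩
      · simp [IsAcyclicEdgeSet, spanning]
      · rintro y ⟨-, hy⟩
        simpa [spanning] using hy
  simp [this, forestWeight]

variable [DecidableEq V]

theorem Q_zero : G.Q 0 = 1 := by
  have h := Q_succ_add_Q_mul_laplacian (G := G) (-1)
  rw [Q_eq_zero_of_forests_eq_empty (k := -1) (forests_eq_empty_of_neg (by norm_num)), zero_mul,
    add_zero] at h
  simpa [forestWeight_forests_zero] using h

theorem forestWeight_forests_one : G.forestWeight (G.forests 1) = G.laplacian.trace := by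
  have h := succ_mul_forestWeight (G := G) 0
  simpa [Q_zero] using h

theorem Q_one : G.Q 1 = G.laplacian.trace • (1 : Matrix V V ℝ) - G.laplacian := by
  have h := Q_succ_add_Q_mul_laplacian (G := G) 0
  rw [Q_zero, one_mul, zero_add, forestWeight_forests_one] at h
  exact eq_sub_of_add_eq h

theorem forestWeight_forests_two :
    G.forestWeight (G.forests 2) = (G.Q 1 * G.laplacian).trace / 2 := by
  have h := succ_mul_forestWeight (G := G) 1
  norm_num at h
  linarith

theorem Q_two : G.Q 2 = G.forestWeight (G.forests 2) • (1 : Matrix V V ℝ) - G.Q 1 * G.laplacian :=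
  eq_sub_of_add_eq (Q_succ_add_Q_mul_laplacian (G := G) 1)

end

/-! ### Multigraphs on three vertices -/

variable {G : WMultigraph (Fin 3)} {a c : ℝ}

/-- The only edges other than loops join `0` with `1`, of total weight `a`, and `0` with `2`, of
total weight `c`. -/
structure IsStar (G : WMultigraph (Fin 3)) (a c : ℝ) : Prop where
  weight_zero_one : G.totalWeight 0 1 = a
  weight_zero_two : G.totalWeight 0 2 = c
  weight_one_two : G.totalWeight 1 2 = 0

theorem IsStar.laplacian_eq (h : G.IsStar a c) :
    G.laplacian = !![a + c, -a, -c; -a, a, 0; -c, 0, c] := by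
  have h10 := h.weight_zero_one
  have h20 := h.weight_zero_two
  have h21 := h.weight_one_two
  rw [totalWeight_comm] at h10 h20 h21
  ext i j
  fin_cases i <;> fin_cases j <;>
    simp [laplacian, Fin.sum_univ_three, add_assoc, h10, h20, h21, h.weight_zero_one,
      h.weight_zero_two, h.weight_one_two]

theorem IsStar.forestWeight_one (h : G.IsStar a c) :
    G.forestWeight (G.forests 1) = 2 * (a + c) := by
  rw [forestWeight_forests_one, h.laplacian_eq, Matrix.trace_fin_three]
  simp
  ring

theorem IsStar.Q_one (h : G.IsStar a c) :
    G.Q 1 = !![a + c, a, c; a, a + 2 * c, 0; c, 0, 2 * a + c] := by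
  rw [WMultigraph.Q_one, ← forestWeight_forests_one, h.forestWeight_one, h.laplacian_eq]
  ext i j
  fin_cases i <;> fin_cases j <;> simp <;> ring

theorem IsStar.Q_one_mul_laplacian (h : G.IsStar a c) :
    G.Q 1 * G.laplacian = !![2 * (a * c), -(a * c), -(a * c); -(a * c), 2 * (a * c), -(a * c);
      -(a * c), -(a * c), 2 * (a * c)] := by
  rw [h.Q_one, h.laplacian_eq]
  ext i j
  fin_cases i <;> fin_cases j <;> simp [Matrix.mul_apply, Fin.sum_univ_three] <;> ring

theorem IsStar.forestWeight_two (h : G.IsStar a c) :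
    G.forestWeight (G.forests 2) = 3 * (a * c) := by
  rw [forestWeight_forests_two, h.Q_one_mul_laplacian, Matrix.trace_fin_three]
  simp
  ring

theorem IsStar.Q_two_apply (h : G.IsStar a c) (i j : Fin 3) : G.Q 2 i j = a * c := by
  rw [Q_two, h.Q_one_mul_laplacian, h.forestWeight_two]
  fin_cases i <;> fin_cases j <;> simp <;> ring

theorem IsStar.rank_eq_two (h : G.IsStar a c) (ha : 0 < a) (hc : 0 < c) : G.rank = 2 := by
  have h1 : 2 ≤ G.rank := le_rank_of_forestWeight_pos (by rw [h.forestWeight_two]; positivity)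
  have h2 : 0 < G.numComponents := Nat.card_pos
  simp only [rank, Fintype.card_fin] at h1 ⊢
  omega

theorem IsStar.not_reachable (h : G.IsStar a 0) {i : Fin 3} (hi : i ≠ 2) :
    ¬ G.graph.Reachable i 2 := by
  intro hr
  have h20 := h.weight_zero_two
  have h21 := h.weight_one_two
  rw [totalWeight_comm] at h20 h21
  -- The indicator of the isolated vertex `2` lies in the kernel of `L`, so it is constant on
  -- components.
  have := eq_of_reachable_of_laplacian (f := fun x : Fin 3 => if x = 2 then (1 : ℝ) else 0)
    (fun x => by
      fin_cases x <;> simp [Fin.sum_univ_three, h20, h21, h.weight_zero_two, h.weight_one_two]) hr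
  simp [hi] at this

theorem IsStar.rank_eq_one (h : G.IsStar a 0) (ha : 0 < a) : G.rank = 1 := by
  have h1 : 1 ≤ G.rank := le_rank_of_forestWeight_pos (by rw [h.forestWeight_one]; positivity)
  have h2 : 1 < G.numComponents := by
    rw [numComponents, Finite.one_lt_card_iff_nontrivial]
    exact ⟨G.graph.connectedComponentMk 0, G.graph.connectedComponentMk 2,
      fun he => h.not_reachable (by decide) (ConnectedComponent.exact he)⟩
  simp only [rank, Fintype.card_fin] at h1 ⊢
  omega

theorem IsStar.admissible_iff (h : G.IsStar a c) (ha : 0 < a) (hc : 0 < c) {α : ℝ} :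
    G.Admissible α ↔ 0 < α ∧ α * (2 * (a + c)) < 3 * (a * c) := by
  rw [Admissible, h.rank_eq_two ha hc, h.forestWeight_two,
    show (2 : ℤ) - 1 = 1 by norm_num, h.forestWeight_one]

theorem IsStar.admissible_iff_of_zero (h : G.IsStar a 0) (ha : 0 < a) {α : ℝ} :
    G.Admissible α ↔ 0 < α ∧ α < 2 * a := by
  rw [Admissible, h.rank_eq_one ha, h.forestWeight_one, sub_self, forestWeight_forests_zero,
    mul_one, add_zero]

/-- All entries of `Q_2` are equal, so `α` enters only through an additive constant common to all
entries. -/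
theorem IsStar.accessibility_apply (h : G.IsStar a c) (ha : 0 < a) (hc : 0 < c) {α : ℝ}
    (hα : G.Admissible α) (i j : Fin 3) :
    G.accessibility α i j =
      G.Q 1 i j / (3 * (a * c)) + (α⁻¹ - 2 * (a + c) / (3 * (a * c))) / 3 := by
  rw [hα.accessibility_eq, h.rank_eq_two ha hc, h.forestWeight_two,
    show (2 : ℤ) - 1 = 1 by norm_num, h.forestWeight_one]
  simp only [Matrix.add_apply, Matrix.smul_apply, smul_eq_mul, h.Q_two_apply]
  field_simp

theorem IsStar.accessibility_apply_of_zero (h : G.IsStar a 0) (ha : 0 < a) {α : ℝ}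
    (hα : G.Admissible α) (i j : Fin 3) :
    G.accessibility α i j =
      (1 : Matrix (Fin 3) (Fin 3) ℝ) i j / (2 * a) +
        (α⁻¹ - 1 / (2 * a)) * (G.Q 1 i j / (2 * a)) := by
  rw [hα.accessibility_eq, h.rank_eq_one ha, h.forestWeight_one, sub_self,
    forestWeight_forests_zero, Q_zero]
  simp only [Matrix.add_apply, Matrix.smul_apply, smul_eq_mul, add_zero]
  ring

theorem IsStar.hasPath_one_zero (h : G.IsStar a c) (ha : 0 < a) : G.HasPath 1 0 :=
  hasPath_iff.2 (reachable_of_totalWeight_ne_zero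
    (by rw [totalWeight_comm, h.weight_zero_one]; exact ha.ne'))

theorem IsStar.allPathsThrough (h : G.IsStar a 0) {i : Fin 3} (hi : i ≠ 2) (k : Fin 3) :
    G.AllPathsThrough i 2 k := fun p => absurd ⟨p.1⟩ (h.not_reachable hi)

theorem IsStar.addEdge (h : G.IsStar a c) {w : ℝ} (hw : 0 < w) :
    (G.addEdge 0 2 w hw).IsStar a (w + c) := by
  refine ⟨?_, ?_, ?_⟩ <;> rw [totalWeight_addEdge]
  · rw [if_neg (by decide), zero_add, h.weight_zero_one]
  · rw [if_pos rfl, h.weight_zero_two]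
  · rw [if_neg (by decide), zero_add, h.weight_one_two]

theorem IsStar.addEdge_of_zero (h : G.IsStar a 0) {w : ℝ} (hw : 0 < w) :
    (G.addEdge 0 2 w hw).IsStar a w := by
  simpa using h.addEdge hw

theorem oneEdge_isStar : oneEdge.IsStar 1 0 := by
  refine ⟨(Fintype.sum_unique (ι := Unit) _).trans (if_pos rfl), ?_, ?_⟩ <;>
    simp [totalWeight, oneEdge]

/-- The multigraph on three vertices without edges. -/
def noEdges : WMultigraph (Fin 3) where
  Edge := Empty
  ends := fun e => e.elim
  weight := fun e => e.elim
  weight_pos := fun e => e.elim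

theorem noEdges_addEdge_isStar (ha : 0 < a) : (noEdges.addEdge 0 1 a ha).IsStar a 0 := by
  have h : ∀ i j, noEdges.totalWeight i j = 0 := fun i j => Fintype.sum_empty (ι := Empty) _
  refine ⟨?_, ?_, ?_⟩ <;> rw [totalWeight_addEdge, h] <;> simp

/-! ### Violations of monotonicity -/

variable {α α' w : ℝ}

/-- Strengthening the bond of `0` and `2` in a chain changes the entries `(0, 2)` and `(1, 2)`
equally. -/
theorem IsStar.not_item1_of_chain (h : G.IsStar a c) (ha : 0 < a) (hc : 0 < c) (hw : 0 < w)
    (hα : G.Admissible α) (hα' : (G.addEdge 0 2 w hw).Admissible α') :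
    ¬ Item1 G (G.accessibility α) ((G.addEdge 0 2 w hw).accessibility α') 0 2 := by
  intro hI
  have hlt := hI.2 1 2 (by decide)
  have h' := h.addEdge hw
  have hwc : 0 < w + c := by positivity
  simp only [Matrix.sub_apply] at hlt
  rw [h'.accessibility_apply ha hwc hα', h'.accessibility_apply ha hwc hα',
    h.accessibility_apply ha hc hα, h.accessibility_apply ha hc hα, h'.Q_one, h.Q_one] at hlt
  simp only [Matrix.of_apply, Matrix.cons_val] at hlt
  -- Both sides equal `1 / (3 * a)`: entry `(0, 2)` does not see the weight of its own bond beyond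
  -- the common constant.
  have e1 : (w + c) / (3 * (a * (w + c))) = c / (3 * (a * c)) := by field_simp
  rw [e1] at hlt
  simp at hlt

theorem IsStar.accessibility_sub (h : G.IsStar a 0) (ha : 0 < a) (hw : 0 < w)
    (hα : G.Admissible α) (hα' : (G.addEdge 0 2 w hw).Admissible α') (i j : Fin 3) :
    ((G.addEdge 0 2 w hw).accessibility α' - G.accessibility α) i j =
      ((!![a + w, a, w; a, a + 2 * w, 0; w, 0, 2 * a + w] : Matrix (Fin 3) (Fin 3) ℝ) i j /
          (3 * (a * w)) + (α'⁻¹ - 2 * (a + w) / (3 * (a * w))) / 3) -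
        ((1 : Matrix (Fin 3) (Fin 3) ℝ) i j / (2 * a) + (α⁻¹ - 1 / (2 * a)) *
          ((!![a, a, 0; a, a, 0; 0, 0, 2 * a] : Matrix (Fin 3) (Fin 3) ℝ) i j / (2 * a))) := by
  have h' := h.addEdge_of_zero hw
  rw [Matrix.sub_apply, h'.accessibility_apply ha hw hα', h.accessibility_apply_of_zero ha hα,
    h'.Q_one, h.Q_one]
  simp only [add_zero, mul_zero]

theorem not_items_of_le (hw : 0 < w) (hα : oneEdge.Admissible α) (hle : w ≤ 2 * α / 3)
    (hα' : (oneEdge.addEdge 0 2 w hw).Admissible α') :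
    ¬ Item1 oneEdge (oneEdge.accessibility α)
        ((oneEdge.addEdge 0 2 w hw).accessibility α') 0 2 ∧
      ¬ Item2 oneEdge (oneEdge.accessibility α)
        ((oneEdge.addEdge 0 2 w hw).accessibility α') 0 2 ∧
      ¬ Item3 oneEdge (oneEdge.accessibility α)
        ((oneEdge.addEdge 0 2 w hw).accessibility α') 0 2 := by
  have hG := oneEdge_isStar
  have hsub := hG.accessibility_sub one_pos hw hα hα'
  have hpath := hG.hasPath_one_zero one_pos
  have hall := hG.allPathsThrough (i := 1) (by decide) 0
  -- Three times the constant common to all entries after the change; it is positive by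
  -- admissibility of `α'`.
  have hC : 0 < α'⁻¹ - 2 * (1 + w) / (3 * w) := by
    obtain ⟨h1, h2⟩ := ((hG.addEdge_of_zero hw).admissible_iff one_pos hw).1 hα'
    rw [sub_pos, div_lt_iff₀ (by positivity), inv_mul_eq_div, lt_div_iff₀ h1]
    linarith
  -- The only use of `w ≤ 2α/3`. It leaves a surplus of at least `1/12` for `Δp_11 - Δp_02`, and of
  -- at least `1/4` for `Δp_10 - Δp_12` and for `Δp_10`.
  have hinv : 1 / (2 * α) ≤ 1 / (3 * w) :=
    one_div_le_one_div_of_le (by positivity) (by linarith)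
  have hα0 : 0 < α := hα.1
  have e1 : α⁻¹ = 2 * (1 / (2 * α)) := by field_simp
  have e2 : (1 + 2 * w) / (3 * w) = 1 / (3 * w) + 2 / 3 := by field_simp
  have e3 : w / (3 * w) = 1 / 3 := by field_simp
  refine ⟨fun hI => ?_, fun hI => ?_, fun hI => ?_⟩
  · have hlt := hI.2 1 1 (by decide)
    rw [hsub, hsub] at hlt
    simp only [Matrix.of_apply, Matrix.cons_val, Matrix.one_apply_eq, one_mul,
      Matrix.one_apply_ne (show (0 : Fin 3) ≠ 2 by decide)] at hlt
    rw [e1, e2, e3] at hlt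
    linarith
  · have hlt := hI 1 hpath hall
    rw [hsub, hsub] at hlt
    simp only [Matrix.of_apply, Matrix.cons_val, one_mul, zero_div,
      Matrix.one_apply_ne (show (1 : Fin 3) ≠ 2 by decide),
      Matrix.one_apply_ne (show (1 : Fin 3) ≠ 0 by decide)] at hlt
    rw [e1] at hlt
    linarith
  · have hle := sub_nonpos.2 (hI 1 0 hpath hall (hasPath_iff.2 (Reachable.refl _))
      (hG.allPathsThrough (by decide) 0))
    rw [← Matrix.sub_apply, hsub] at hle
    simp only [Matrix.of_apply, Matrix.cons_val, one_mul, zero_div,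
      Matrix.one_apply_ne (show (1 : Fin 3) ≠ 0 by decide)] at hle
    rw [e1] at hle
    linarith

theorem not_monotoneOn_item1 (hα : 0 < α) :
    ¬ MonotoneOn Item1 {G : WMultigraph (Fin 3) | G.Admissible α}
      (fun G => G.accessibility α) := by
  intro hM
  have h2 : 0 < 2 * α := by positivity
  -- Equal weights `s` in the chain are admissible for `s > 4α/3`; the value `2α` serves, also after
  -- the addition.
  have hG := (noEdges_addEdge_isStar h2).addEdge_of_zero h2
  have hG' := hG.addEdge h2
  have hadm := (hG.admissible_iff h2 h2 (α := α)).2 ⟨hα, by nlinarith [mul_pos hα hα]⟩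
  have hadm' := (hG'.admissible_iff h2 (by positivity) (α := α)).2
    ⟨hα, by nlinarith [mul_pos hα hα]⟩
  exact hG.not_item1_of_chain h2 h2 h2 hadm hadm'
    (hM _ hadm _ hadm' 0 2 (by decide) (Strengthens.new _ _ _))

theorem not_monotoneOn_item3 (hα : 0 < α) :
    ¬ MonotoneOn Item3 {G : WMultigraph (Fin 3) | G.Admissible α}
      (fun G => G.accessibility α) := by
  intro hM
  have h4 : 0 < 4 * α := by positivity
  have hG := noEdges_addEdge_isStar hα
  -- With first weight `α`, admissibility after the addition means a new weight above `2α`; `4α` is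
  -- one choice. The entry `(1, 1)` then grows by `1 / (18 * α)`.
  have hG' := hG.addEdge_of_zero h4
  have hadm := (hG.admissible_iff_of_zero hα (α := α)).2 ⟨hα, by linarith⟩
  have hadm' := (hG'.admissible_iff hα h4 (α := α)).2 ⟨hα, by nlinarith [mul_pos hα hα]⟩
  have hpath := hG.hasPath_one_zero hα
  have hall := hG.allPathsThrough (i := 1) (by decide) 0
  have hle := sub_nonpos.2 (hM _ hadm _ hadm' 0 2 (by decide) (Strengthens.new _ _ _)
    1 1 hpath hall hpath hall)
  rw [← Matrix.sub_apply, hG.accessibility_sub hα h4 hadm hadm'] at hle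
  simp only [Matrix.of_apply, Matrix.cons_val, Matrix.one_apply_eq] at hle
  have hval : (α + 2 * (4 * α)) / (3 * (α * (4 * α))) +
      (α⁻¹ - 2 * (α + 4 * α) / (3 * (α * (4 * α)))) / 3 -
      (1 / (2 * α) + (α⁻¹ - 1 / (2 * α)) * (α / (2 * α))) = 1 / (18 * α) := by
    field_simp
    norm_num
  rw [hval] at hle
  have : 0 < 1 / (18 * α) := by positivity
  linarith

end WMultigraph

open WMultigraph in
theorem proposition10 :
    -- representation by dense forests with positive coefficients, and the normative properties
    (∀ (V : Type*) [Fintype V] [DecidableEq V] (G : WMultigraph V) (α : ℝ), G.Admissible α →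
      IsUnit (G.laplacian + α • G.Jbar) ∧
      (∃ a b : ℝ, 0 < a ∧ 0 < b ∧
        a = 1 / G.forestWeight (G.forests G.rank) ∧
        b = 1 / G.forestWeight (G.forests G.rank) *
          (α⁻¹ - G.forestWeight (G.forests (G.rank - 1)) / G.forestWeight (G.forests G.rank)) ∧
        G.accessibility α = a • G.Q (G.rank - 1) + b • G.Q G.rank) ∧
      Symmetry (G.accessibility α) ∧
      Nonnegativity (G.accessibility α) ∧
      DiagonalMaximality (G.accessibility α) ∧
      TriangleInequality (G.accessibility α) ∧
      DisconnectionCondition G (G.accessibility α) ∧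
      TransitProperty G (G.accessibility α)) ∧
    -- violation of monotonicity for every choice of admissible parameters, already on 3 vertices
    (∀ a : WMultigraph (Fin 3) → ℝ, (∀ G : WMultigraph (Fin 3), G.Admissible (a G)) →
      ¬ MonotoneOn Item1 Set.univ (fun G => G.accessibility (a G)) ∧
      ¬ MonotoneOn Item2 Set.univ (fun G => G.accessibility (a G)) ∧
      ¬ MonotoneOn Item3 Set.univ (fun G => G.accessibility (a G))) ∧
    -- violation of monotonicity for every fixed parameter, already on 3 vertices
    (∀ α : ℝ, 0 < α →
      ¬ MonotoneOn Item1 {G : WMultigraph (Fin 3) | G.Admissible α}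
        (fun G => G.accessibility α) ∧
      ¬ MonotoneOn Item3 {G : WMultigraph (Fin 3) | G.Admissible α}
        (fun G => G.accessibility α)) ∧
    -- an explicit example on 3 vertices: the edge between 0 and 2 is added to the edge between 0, 1
    (∀ α : ℝ, oneEdge.Admissible α ↔ 0 < α ∧ α < 2) ∧
    (∀ (α α' w : ℝ) (hw : 0 < w), oneEdge.Admissible α → w ≤ 2 * α / 3 →
      (oneEdge.addEdge 0 2 w hw).Admissible α' →
      ¬ Item1 oneEdge (oneEdge.accessibility α)
        ((oneEdge.addEdge 0 2 w hw).accessibility α') 0 2 ∧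
      ¬ Item2 oneEdge (oneEdge.accessibility α)
        ((oneEdge.addEdge 0 2 w hw).accessibility α') 0 2 ∧
      ¬ Item3 oneEdge (oneEdge.accessibility α)
        ((oneEdge.addEdge 0 2 w hw).accessibility α') 0 2) ∧
    -- in the resulting 2-edge chain, a further edge between 0 and 2 violates the strict inequality
    (∀ (α α' c w : ℝ) (hc : 0 < c) (hw : 0 < w),
      (oneEdge.addEdge 0 2 c hc).Admissible α →
      ((oneEdge.addEdge 0 2 c hc).addEdge 0 2 w hw).Admissible α' →
      ¬ Item1 (oneEdge.addEdge 0 2 c hc)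
        ((oneEdge.addEdge 0 2 c hc).accessibility α)
        (((oneEdge.addEdge 0 2 c hc).addEdge 0 2 w hw).accessibility α') 0 2) := by
  refine ⟨fun V _ _ G α h => ⟨h.isUnit, ⟨_, _, one_div_pos.2 h.forestWeight_pos,
      mul_pos (one_div_pos.2 h.forestWeight_pos) h.coeff_pos, rfl, rfl, h.accessibility_eq⟩,
      h.symmetry, h.nonnegativity, h.diagonalMaximality, h.triangleInequality,
      h.disconnectionCondition, h.transitProperty⟩,
    fun a ha => ?_, fun α hα => ⟨not_monotoneOn_item1 hα, not_monotoneOn_item3 hα⟩,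
    fun α => by simpa using oneEdge_isStar.admissible_iff_of_zero one_pos,
    fun α α' w hw hα hle hα' => not_items_of_le hw hα hle hα',
    fun α α' c w hc hw hα hα' =>
      (oneEdge_isStar.addEdge_of_zero hc).not_item1_of_chain one_pos hc hw hα hα'⟩
  -- The largest weight allowed by the explicit example. It depends only on the parameter chosen for
  -- `oneEdge`, while the one chosen for the enlarged multigraph is arbitrary.
  have hw : 0 < 2 * a oneEdge / 3 := by
    have := (ha oneEdge).1
    positivity
  obtain ⟨h1, h2, h3⟩ := not_items_of_le hw (ha oneEdge) le_rfl (ha _)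
  exact ⟨fun hM => h1 (hM _ trivial _ trivial 0 2 (by decide) (Strengthens.new _ _ _)),
    fun hM => h2 (hM _ trivial _ trivial 0 2 (by decide) (Strengthens.new _ _ _)),
    fun hM => h3 (hM _ trivial _ trivial 0 2 (by decide) (Strengthens.new _ _ _))⟩
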